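/- **Setting.** Let $K$ be a field, $s\ge 2$, $S=K[t_1,\dots,t_s]$ with the standard grading. For a graded ideal $I\neq (0)$ let $H_I(d)=\dim_K(S_d/I_d)$, and let $\deg(S/I)=(k-1)!\lim_{d\to\infty}H_I(d)/d^{k-1}$ if $k=\dim(S/I)\ge 1$ and $\deg(S/I)=\dim_K(S/I)$ if $k=0$. Let $\prec$ be a graded monomial order (one that compares total degrees first), ${\rm in}_\prec(I)$ the initial ideal of $I$, and $\Delta_\prec(I)$ the set of monomials not in ${\rm in}_\prec(I)$. For $d\ge 1$ let $\mathcal M_{\prec,d}$ be the set of monomials $t^a\in\Delta_\prec(I)$ of degree $d$ that are zero-divisors of $S/{\rm in}_\prec(I)$, and $\mathcal F_{\prec,d}$ the set of nonzero $K$-linear combinations $f$ of monomials of degree $d$ in $\Delta_\prec(I)$ that are zero-divisors of $S/I$. Put $${\rm fp}_I(d)=\deg(S/I)-\max\{\deg(S/({\rm in}_\prec(I),t^a)) : t^a\in\mathcal M_{\prec,d}\},\qquad \delta_I(d)=\deg(S/I)-\max\{\deg(S/(I,f)) : f\in\mathcal F_{\prec,d}\},$$ where the maximum is replaced by $0$ if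 the set in question is empty. The ideal $I$ is *Geil–Carvalho* if, for some graded monomial order $\prec$, $\delta_I(d)={\rm fp}_I(d)$ for all $d\ge 1$. For a finite set $\mathbb X\subset\mathbb P^{s-1}$ over $K$, the vanishing ideal $I(\mathbb X)$ is generated by the homogeneous polynomials that vanish at all points of $\mathbb X$. For $d\ge 1$ choose for each $P\in\mathbb X$ a form $f_P\in S_d$ with $f_P(P)\ne 0$; the projective Reed–Muller-type code $C_{\mathbb X}(d)\subset K^{\mathbb X}$ is the image of $S_d\to K^{\mathbb X}$, $f\mapsto (f(P)/f_P(P))_{P\in\mathbb X}$, and $\delta_{\mathbb X}(d)$ is its minimum distance, i.e. the least number of nonzero entries of a nonzero element of $C_{\mathbb X}(d)$. **Statement.** Let $A_2,\dots,A_s$ be finite subsets of $K$ with $d_i=|A_i|$ and $1\le d_i\le d_{i+1}$ for $i\ge 2$, and let $\mathbb X=[1\times A_2\times\cdots\times A_s]=\{[(1,x_2,\dots,x_s)] : x_i\in A_i\}\subset\mathbb P^{s-1}$. Let $d\ge 1$, and let the forms $f_P$ be chosen arbitrarily. 1. If $d\le\sum_{i=2}^s(d_i-1)-1$, then there are unique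 integers $k,\ell$ with $0\le k\le s-2$, $d=\sum_{i=2}^{k+1}(d_i-1)+\ell$ and $1\le\ell\le d_{k+2}-1$, and $\delta_{\mathbb X}(d)=(d_{k+2}-\ell)\,d_{k+3}\cdots d_s$. 2. If $d\ge\sum_{i=2}^s(d_i-1)$, then $\delta_{\mathbb X}(d)=1$. 3. The ideal $I(\mathbb X)$ is Geil–Carvalho. More precisely, for every graded monomial order $\prec$ with $t_1\prec t_i$ for $i=2,\dots,s$, one has $\delta_{I(\mathbb X)}(d)={\rm fp}_{I(\mathbb X)}(d)$ for all $d\ge 1$. -/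

import Mathlib

open scoped MonomialOrder LinearAlgebra.Projectivization

noncomputable section

namespace FootprintCodes

universe u v

/-! ### Hilbert function and degree -/

section Degree

variable {σ : Type u} {K : Type v} [Field K]

/-- The Hilbert function `H_I(d) = dim_K (S_d / I_d)` of `S/I`, where `S = K[t_i : i ∈ σ]` and
`I_d = I ∩ S_d`. -/
def hilbertFunction (I : Ideal (MvPolynomial σ K)) (d : ℕ) : ℕ :=
  Module.finrank K
    (↥(MvPolynomial.homogeneousSubmodule σ K d) ⧸
      (I.restrictScalars K).comap (MvPolynomial.homogeneousSubmodule σ K d).subtype)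

/-- The Krull dimension of `S/I`, as a natural number (`0` for the zero ring). -/
def dimension (I : Ideal (MvPolynomial σ K)) : ℕ :=
  ((ringKrullDim (MvPolynomial σ K ⧸ I)).unbotD 0).toNat

/-- The degree (multiplicity) of `S/I` for a graded ideal `I`: with `k = dim (S/I)`, it is
`(k - 1)! * lim H_I(d) / d ^ (k - 1)` if `k ≥ 1`, and `dim_K (S/I)` if `k = 0`.
It is an integer, but it is kept as a real number because it is defined by a limit. -/
def degree (I : Ideal (MvPolynomial σ K)) : ℝ :=
  if dimension I = 0 then (Module.finrank K (MvPolynomial σ K ⧸ I) : ℝ)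
  else (Nat.factorial (dimension I - 1) : ℝ) *
    Filter.limUnder Filter.atTop
      (fun d : ℕ => (hilbertFunction I d : ℝ) / (d : ℝ) ^ (dimension I - 1))

end Degree

/-! ### Footprint and minimum distance functions of an ideal -/

section Footprint

variable {σ : Type u} {K : Type v} [Field K]

/-- A monomial order is graded if it compares total degrees first. -/
def IsGradedOrder (m : MonomialOrder σ) : Prop :=
  ∀ a b : σ →₀ ℕ, a.degree < b.degree → a ≺[m] b

/-- The initial ideal of `I`, generated by the leading monomials of the nonzero elements. -/
def initialIdeal (m : MonomialOrder σ) (I : Ideal (MvPolynomial σ K)) :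
    Ideal (MvPolynomial σ K) :=
  Ideal.span {p | ∃ f ∈ I, f ≠ 0 ∧ p = MvPolynomial.monomial (m.degree f) 1}

/-- The footprint of `S/I`: (exponents of) the monomials that are not in the initial ideal. -/
def footprint (m : MonomialOrder σ) (I : Ideal (MvPolynomial σ K)) : Set (σ →₀ ℕ) :=
  {a | MvPolynomial.monomial a (1 : K) ∉ initialIdeal m I}

/-- The class of `f` is a zero-divisor of `S/I`, that is, `(I : f) ≠ I`. -/
def IsZeroDivisorMod (I : Ideal (MvPolynomial σ K)) (f : MvPolynomial σ K) : Prop :=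
  ∃ g, g ∉ I ∧ g * f ∈ I

/-- (Exponents of) the monomials of degree `d` in the footprint that are zero-divisors of
`S/in(I)`. -/
def zeroDivisorMonomials (m : MonomialOrder σ) (I : Ideal (MvPolynomial σ K)) (d : ℕ) :
    Set (σ →₀ ℕ) :=
  {a | a ∈ footprint m I ∧ a.degree = d ∧
    IsZeroDivisorMod (initialIdeal m I) (MvPolynomial.monomial a (1 : K))}

/-- The nonzero `K`-linear combinations of monomials of degree `d` in the footprint that are
zero-divisors of `S/I`. -/
def zeroDivisorPolynomials (m : MonomialOrder σ) (I : Ideal (MvPolynomial σ K)) (d : ℕ) :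
    Set (MvPolynomial σ K) :=
  {f | f ≠ 0 ∧ (∀ a ∈ f.support, a ∈ footprint m I ∧ a.degree = d) ∧ IsZeroDivisorMod I f}

open Classical in
/-- The footprint function `fp_I`. -/
def footprintFunction (m : MonomialOrder σ) (I : Ideal (MvPolynomial σ K)) (d : ℕ) : ℝ :=
  if (zeroDivisorMonomials m I d).Nonempty then
    degree I - sSup ((fun a : σ →₀ ℕ =>
      degree (initialIdeal m I ⊔ Ideal.span {MvPolynomial.monomial a (1 : K)})) ''
        zeroDivisorMonomials m I d)
  else degree I

open Classical in
/-- The minimum distance function `δ_I`. -/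
def minDistFunction (m : MonomialOrder σ) (I : Ideal (MvPolynomial σ K)) (d : ℕ) : ℝ :=
  if (zeroDivisorPolynomials m I d).Nonempty then
    degree I - sSup ((fun f : MvPolynomial σ K => degree (I ⊔ Ideal.span {f})) ''
      zeroDivisorPolynomials m I d)
  else degree I

/-- `I` is a Geil--Carvalho ideal: `δ_I(d) = fp_I(d)` for all `d ≥ 1`, with respect to some
graded monomial order. -/
def IsGeilCarvalho (I : Ideal (MvPolynomial σ K)) : Prop :=
  ∃ m : MonomialOrder.{u, u} σ, IsGradedOrder m ∧
    ∀ d : ℕ, 1 ≤ d → minDistFunction m I d = footprintFunction m I d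

end Footprint

/-! ### Projective Reed--Muller-type codes -/

section Codes

variable {σ : Type u} {K : Type v} [Field K]

/-- The vanishing ideal of a set of projective points, generated by the homogeneous polynomials
vanishing at all the points. -/
def vanishingIdeal (X : Set (ℙ K (σ → K))) : Ideal (MvPolynomial σ K) :=
  Ideal.span {f | (∃ d : ℕ, f.IsHomogeneous d) ∧ ∀ P ∈ X, MvPolynomial.eval P.rep f = 0}

/-- A family `g` of forms of degree `d`, one for each point `P` of `X`, with `g P` not vanishing
at `P`. -/
def IsNormalizingFamily (X : Set (ℙ K (σ → K))) (d : ℕ) (g : X → MvPolynomial σ K) : Prop :=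
  ∀ P : X, (g P).IsHomogeneous d ∧ MvPolynomial.eval P.1.rep (g P) ≠ 0

/-- The evaluation map `S_d → K^X`, `f ↦ (f(P) / g_P(P))_P`. -/
def evalMap (X : Set (ℙ K (σ → K))) (d : ℕ) (g : X → MvPolynomial σ K) :
    ↥(MvPolynomial.homogeneousSubmodule σ K d) →ₗ[K] (X → K) where
  toFun f P := MvPolynomial.eval P.1.rep f.1 / MvPolynomial.eval P.1.rep (g P)
  map_add' f h := by
    funext P
    simp [add_div]
  map_smul' c f := by
    funext P
    simp [MvPolynomial.smul_eval, mul_div_assoc]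

/-- The projective Reed--Muller-type code `C_X(d)`: the image of the evaluation map. -/
def reedMullerCode (X : Set (ℙ K (σ → K))) (d : ℕ) (g : X → MvPolynomial σ K) :
    Submodule K (X → K) :=
  LinearMap.range (evalMap X d g)

/-- The minimum distance of a linear code `C ⊆ K^ι` with `ι` finite: the least number of nonzero
entries of a nonzero codeword. -/
def minimumDistance {ι : Type*} (C : Submodule K (ι → K)) : ℕ :=
  sInf {w | ∃ v ∈ C, v ≠ 0 ∧ w = (Function.support v).ncard}

end Codes

/-! ### Cartesian sets -/

section Cartesian

variable {K : Type v} [Field K] {n : ℕ}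

theorem cons_one_ne_zero (x : Fin n → K) : (Fin.cons 1 x : Fin (n + 1) → K) ≠ 0 := by
  intro h
  simpa using congrFun h 0

/-- The set `[1 × A_2 × ⋯ × A_s]` of the points `[(1, x)]` with `x_i ∈ A_i`. With `n = s - 1`,
the coordinate `0 : Fin (n + 1)` is that of `t_1`, and `A i` (for `i : Fin n`) is `A_{i+2}` and
belongs to the coordinate `i.succ`. -/
def cartesianSet (A : Fin n → Finset K) : Set (ℙ K (Fin (n + 1) → K)) :=
  {P | ∃ x : Fin n → K, (∀ i, x i ∈ A i) ∧
    P = Projectivization.mk K (Fin.cons 1 x : Fin (n + 1) → K) (cons_one_ne_zero x)}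

end Cartesian

end FootprintCodes

end

/-! A form vanishes at a point [(1, x)] exactly when it vanishes at (1, x), so I(X) is the
intersection, over the grid of all x in ∏ A_i, of the kernels of restriction to the line through (1,
x). The forms ∏_{γ ∈ A_i} (t_{i+1} - γ t_0) lie in I(X). If t_0 is the smallest variable, their
leading monomials are t_{i+1}^{|A_i|}. Division by them leaves remainders in the box a_{i+1} <
|A_i|, and a nonzero polynomial supported in the box cannot lie in I(X). Hence these powers generate
the initial ideal.

Degrees now become counts. For a form f with a zero on the grid, S/(I(X), f) has degree the number
of its zeros (`degree_vanishingIdeal_sup_span`). For a monomial involving some t_{i+1}, S/(in I(X),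
t^a) has degree ∏ |A_i| - ∏ (|A_i| - a_{i+1}) (`degree_initialIdeal_sup_span`). The two sides are
joined by the footprint bound `prod_sub_le_card_nonzeros`, which is attained by products of linear
forms (`exists_form_card_nonzeros_eq`). This gives δ = fp.

The same two lemmas identify the minimum distance of the code with the minimum of ∏ (|A_i| - c_i)
over c_i < |A_i| with ∑ c_i ≤ d. Since the sizes increase, an exchange argument shows that spending
d greedily on the smallest sets is optimal (`greedyProduct_le_prod`). -/

noncomputable section

namespace FootprintCodes

open MvPolynomial

/-! ### Restriction to lines and interpolation on the grid -/

section Lines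

variable {K : Type*} [Field K] {n : ℕ}

/-- The affine representative `(1, x)` of a point of the chart `t₀ ≠ 0`. -/
abbrev chartPoint (x : Fin n → K) : Fin (n + 1) → K := Fin.cons 1 x

/-- Restriction of polynomials to the line through the origin and `(1, x)`. -/
def lineRestriction (x : Fin n → K) : MvPolynomial (Fin (n + 1)) K →ₐ[K] Polynomial K :=
  aeval fun i => Polynomial.C (chartPoint x i) * Polynomial.X

theorem lineRestriction_monomial (x : Fin n → K) (a : Fin (n + 1) →₀ ℕ) (c : K) :
    lineRestriction x (monomial a c) =
      Polynomial.C (eval (chartPoint x) (monomial a c)) * Polynomial.X ^ a.degree := by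
  rw [lineRestriction, aeval_monomial, eval_monomial, Finsupp.degree_apply, map_mul, Finsupp.prod,
    Finsupp.prod, map_prod, ← Finset.prod_pow_eq_pow_sum, mul_assoc, ← Finset.prod_mul_distrib]
  simp only [map_pow, mul_pow]
  rfl

theorem lineRestriction_of_isHomogeneous (x : Fin n → K) {f : MvPolynomial (Fin (n + 1)) K}
    {d : ℕ} (hf : f.IsHomogeneous d) :
    lineRestriction x f = Polynomial.C (eval (chartPoint x) f) * Polynomial.X ^ d := by
  conv_lhs => rw [f.as_sum]
  conv_rhs => rw [f.as_sum]
  rw [map_sum, map_sum, map_sum, Finset.sum_mul]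
  refine Finset.sum_congr rfl fun a ha => ?_
  rw [lineRestriction_monomial, hf.degree_eq_sum_deg_support ha, Finsupp.degree_apply]

theorem lineRestriction_eq_zero_iff_of_isHomogeneous (x : Fin n → K)
    {f : MvPolynomial (Fin (n + 1)) K} {d : ℕ} (hf : f.IsHomogeneous d) :
    lineRestriction x f = 0 ↔ eval (chartPoint x) f = 0 := by
  simp [lineRestriction_of_isHomogeneous x hf]

/-- A single ring homomorphism thus records the values at (1, x) of all homogeneous components,
which extends vanishing conditions on forms to arbitrary polynomials. -/
theorem coeff_lineRestriction (x : Fin n → K) (f : MvPolynomial (Fin (n + 1)) K) (e : ℕ) :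
    (lineRestriction x f).coeff e = eval (chartPoint x) (homogeneousComponent e f) := by
  induction f using MvPolynomial.induction_on' with
  | monomial a c =>
    rw [lineRestriction_monomial, Polynomial.coeff_C_mul_X_pow,
      homogeneousComponent_of_mem (isHomogeneous_monomial c rfl)]
    split_ifs <;> simp_all
  | add p q hp hq => simp [hp, hq]

theorem lineRestriction_X_zero (x : Fin n → K) : lineRestriction x (X 0) = Polynomial.X := by
  simp [lineRestriction]

theorem lineRestriction_surjective (x : Fin n → K) : Function.Surjective (lineRestriction x) := by
  intro p
  refine ⟨Polynomial.aeval (X 0) p, ?_⟩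
  rw [← Polynomial.aeval_algHom_apply, lineRestriction_X_zero, Polynomial.aeval_X_left_apply]

/-- The form `t_{i+1} - γ t_0`. -/
def linearForm (i : Fin n) (γ : K) : MvPolynomial (Fin (n + 1)) K := X i.succ - C γ * X 0

theorem isHomogeneous_linearForm (i : Fin n) (γ : K) : (linearForm i γ).IsHomogeneous 1 :=
  (isHomogeneous_X _ _).sub (isHomogeneous_C_mul_X _ _)

@[simp]
theorem eval_linearForm (x : Fin n → K) (i : Fin n) (γ : K) :
    eval (chartPoint x) (linearForm i γ) = x i - γ := by
  simp [linearForm]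

/-- The product of the forms `t_{i+1} - γ t_0` for `γ ∈ B`. -/
def lineProduct (i : Fin n) (B : Finset K) : MvPolynomial (Fin (n + 1)) K :=
  ∏ γ ∈ B, linearForm i γ

theorem isHomogeneous_lineProduct (i : Fin n) (B : Finset K) :
    (lineProduct i B).IsHomogeneous B.card := by
  simpa [lineProduct] using IsHomogeneous.prod B (fun γ => linearForm i γ) (fun _ => 1)
    fun γ _ => isHomogeneous_linearForm i γ

@[simp]
theorem eval_lineProduct (x : Fin n → K) (i : Fin n) (B : Finset K) :
    eval (chartPoint x) (lineProduct i B) = ∏ γ ∈ B, (x i - γ) := by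
  simp [lineProduct, map_prod]

theorem eval_lineProduct_eq_zero_iff (x : Fin n → K) (i : Fin n) (B : Finset K) :
    eval (chartPoint x) (lineProduct i B) = 0 ↔ x i ∈ B := by
  simp [Finset.prod_eq_zero_iff, sub_eq_zero]

/-- The product over `i` of the `lineProduct i (B i)`, times `t_0 ^ e`. -/
def boxProduct (e : ℕ) (B : Fin n → Finset K) : MvPolynomial (Fin (n + 1)) K :=
  X 0 ^ e * ∏ i, lineProduct i (B i)

theorem isHomogeneous_boxProduct (e : ℕ) (B : Fin n → Finset K) :
    (boxProduct e B).IsHomogeneous (e + ∑ i, (B i).card) :=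
  (isHomogeneous_X_pow _ _).mul
    (IsHomogeneous.prod _ _ _ fun i _ => isHomogeneous_lineProduct i (B i))

theorem eval_boxProduct_eq_zero_iff (x : Fin n → K) (e : ℕ) (B : Fin n → Finset K) :
    eval (chartPoint x) (boxProduct e B) = 0 ↔ ∃ i, x i ∈ B i := by
  simp only [boxProduct, map_mul, map_pow, eval_X, Fin.cons_zero, one_pow, one_mul, map_prod,
    Finset.prod_eq_zero_iff, Finset.mem_univ, true_and, eval_lineProduct_eq_zero_iff]

/-- Forms of large degree interpolate arbitrary values on a finite grid. -/
theorem exists_isHomogeneous_eval_eq (A : Fin n → Finset K) {N : ℕ}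
    (hN : ∑ i, ((A i).card - 1) ≤ N) (v : (Fin n → K) → K) :
    ∃ f : MvPolynomial (Fin (n + 1)) K, f.IsHomogeneous N ∧
      ∀ x ∈ Fintype.piFinset A, eval (chartPoint x) f = v x := by
  classical
  -- Homogeneous Lagrange form at `y`: it vanishes at all other grid points, and the power of t_0
  -- that pads its degree equals 1 on the chart.
  let q : (Fin n → K) → MvPolynomial (Fin (n + 1)) K := fun y =>
    boxProduct (N - ∑ i, ((A i).card - 1)) fun i => (A i).erase (y i)
  have hq : ∀ y ∈ Fintype.piFinset A, (q y).IsHomogeneous N := by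
    intro y hy
    rw [Fintype.mem_piFinset] at hy
    have := isHomogeneous_boxProduct (N - ∑ i, ((A i).card - 1)) fun i => (A i).erase (y i)
    simp only [Finset.card_erase_of_mem (hy _)] at this
    rwa [Nat.sub_add_cancel hN] at this
  refine ⟨∑ y ∈ Fintype.piFinset A,
    C (v y / eval (chartPoint y) (q y)) * q y,
    IsHomogeneous.sum _ _ _ fun y hy => (hq y hy).C_mul _, fun x hx => ?_⟩
  rw [map_sum, Finset.sum_eq_single x]
  · have : eval (chartPoint x) (q x) ≠ 0 := by
      rw [Ne, eval_boxProduct_eq_zero_iff]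
      simp
    simp [div_mul_cancel₀ _ this]
  · intro y hy hyx
    obtain ⟨i, hi⟩ := Function.ne_iff.mp hyx
    have : eval (chartPoint x) (q y) = 0 := by
      rw [eval_boxProduct_eq_zero_iff]
      exact ⟨i, Finset.mem_erase.2 ⟨hi.symm, Fintype.mem_piFinset.1 hx i⟩⟩
    simp [this]
  · exact fun h => absurd hx h

end Lines

/-! ### The vanishing ideal as an intersection of kernels, and its zero-divisors -/

section Vanishing

variable {K : Type*} [Field K] {n : ℕ}

theorem eval_smul_of_isHomogeneous {σ : Type*} {f : MvPolynomial σ K} {d : ℕ}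
    (hf : f.IsHomogeneous d) (c : K) (v : σ → K) : eval (c • v) f = c ^ d * eval v f := by
  rw [eval_eq, eval_eq, Finset.mul_sum]
  refine Finset.sum_congr rfl fun a ha => ?_
  simp only [Pi.smul_apply, smul_eq_mul, mul_pow, Finset.prod_mul_distrib,
    Finset.prod_pow_eq_pow_sum, hf.degree_eq_sum_deg_support ha]
  ring

theorem eval_rep_eq_zero_iff {f : MvPolynomial (Fin (n + 1)) K} {d : ℕ}
    (hf : f.IsHomogeneous d) (x : Fin n → K) :
    eval (Projectivization.mk K (chartPoint x) (cons_one_ne_zero x)).rep f = 0 ↔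
      eval (chartPoint x) f = 0 := by
  obtain ⟨c, hc⟩ := Projectivization.exists_smul_eq_mk_rep K (chartPoint x) (cons_one_ne_zero x)
  rw [← hc, Units.smul_def, eval_smul_of_isHomogeneous hf]
  simp

theorem forall_mem_cartesianSet {A : Fin n → Finset K} {p : ℙ K (Fin (n + 1) → K) → Prop} :
    (∀ P ∈ cartesianSet A, p P) ↔ ∀ x ∈ Fintype.piFinset A,
      p (Projectivization.mk K (chartPoint x) (cons_one_ne_zero x)) := by
  constructor
  · exact fun h x hx => h _ ⟨x, Fintype.mem_piFinset.1 hx, rfl⟩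
  · rintro h P ⟨x, hx, rfl⟩
    exact h x (Fintype.mem_piFinset.2 hx)

theorem mem_vanishingIdeal_cartesianSet_of_isHomogeneous {A : Fin n → Finset K}
    {f : MvPolynomial (Fin (n + 1)) K} {d : ℕ} (hf : f.IsHomogeneous d)
    (h : ∀ x ∈ Fintype.piFinset A, eval (chartPoint x) f = 0) :
    f ∈ vanishingIdeal (cartesianSet A) :=
  Ideal.subset_span ⟨⟨d, hf⟩, forall_mem_cartesianSet.2 fun x hx =>
    (eval_rep_eq_zero_iff hf x).2 (h x hx)⟩

/-- Each kernel contains the generators of I(X). Conversely, if all restrictions vanish, so do their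
coefficients, hence every homogeneous component vanishes on X and is itself a generator. -/
theorem mem_vanishingIdeal_cartesianSet_iff {A : Fin n → Finset K}
    {f : MvPolynomial (Fin (n + 1)) K} :
    f ∈ vanishingIdeal (cartesianSet A) ↔ ∀ x ∈ Fintype.piFinset A, lineRestriction x f = 0 := by
  constructor
  · intro hf x hx
    have : vanishingIdeal (cartesianSet A) ≤ RingHom.ker (lineRestriction x) := by
      refine Ideal.span_le.2 ?_
      rintro g ⟨⟨d, hd⟩, hg⟩
      exact (lineRestriction_eq_zero_iff_of_isHomogeneous x hd).2
        ((eval_rep_eq_zero_iff hd x).1 (forall_mem_cartesianSet.1 hg x hx))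
    exact this hf
  · intro h
    rw [← sum_homogeneousComponent f]
    refine Ideal.sum_mem _ fun e _ => mem_vanishingIdeal_cartesianSet_of_isHomogeneous
      (homogeneousComponent_isHomogeneous e f) fun x hx => ?_
    rw [← coeff_lineRestriction, h x hx, Polynomial.coeff_zero]

theorem mem_vanishingIdeal_cartesianSet_iff_of_isHomogeneous {A : Fin n → Finset K}
    {f : MvPolynomial (Fin (n + 1)) K} {d : ℕ} (hf : f.IsHomogeneous d) :
    f ∈ vanishingIdeal (cartesianSet A) ↔
      ∀ x ∈ Fintype.piFinset A, eval (chartPoint x) f = 0 := by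
  simp only [mem_vanishingIdeal_cartesianSet_iff,
    lineRestriction_eq_zero_iff_of_isHomogeneous _ hf]

theorem homogeneousComponent_mem_vanishingIdeal_cartesianSet {A : Fin n → Finset K}
    {f : MvPolynomial (Fin (n + 1)) K} (hf : f ∈ vanishingIdeal (cartesianSet A)) (e : ℕ) :
    homogeneousComponent e f ∈ vanishingIdeal (cartesianSet A) := by
  rw [mem_vanishingIdeal_cartesianSet_iff_of_isHomogeneous (homogeneousComponent_isHomogeneous e f)]
  intro x hx
  rw [← coeff_lineRestriction, mem_vanishingIdeal_cartesianSet_iff.1 hf x hx, Polynomial.coeff_zero]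

theorem lineProduct_mem_vanishingIdeal (A : Fin n → Finset K) (i : Fin n) :
    lineProduct i (A i) ∈ vanishingIdeal (cartesianSet A) :=
  mem_vanishingIdeal_cartesianSet_of_isHomogeneous (isHomogeneous_lineProduct i _) fun x hx =>
    (eval_lineProduct_eq_zero_iff x i _).2 (Fintype.mem_piFinset.1 hx i)

/-- A form is a zero-divisor modulo `I(X)` exactly when it vanishes at some point of `X`. -/
theorem isZeroDivisorMod_vanishingIdeal_iff {A : Fin n → Finset K}
    {f : MvPolynomial (Fin (n + 1)) K} {d : ℕ} (hf : f.IsHomogeneous d) :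
    IsZeroDivisorMod (vanishingIdeal (cartesianSet A)) f ↔
      ∃ x ∈ Fintype.piFinset A, eval (chartPoint x) f = 0 := by
  classical
  constructor
  · rintro ⟨g, hg, hgf⟩
    by_contra! h
    refine hg (mem_vanishingIdeal_cartesianSet_iff.2 fun x hx => ?_)
    have := mem_vanishingIdeal_cartesianSet_iff.1 hgf x hx
    rw [map_mul, mul_eq_zero, lineRestriction_eq_zero_iff_of_isHomogeneous x hf] at this
    exact this.resolve_right (h x hx)
  · rintro ⟨x, hx, hfx⟩
    -- The indicator form of the point `x` is not in I(X), but its product with `f` vanishes on the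
    -- whole grid.
    obtain ⟨g, hg, hgx⟩ := exists_isHomogeneous_eval_eq A le_rfl (Pi.single x 1)
    refine ⟨g, fun h => ?_, ?_⟩
    · have := (mem_vanishingIdeal_cartesianSet_iff_of_isHomogeneous hg).1 h x hx
      simp [hgx x hx] at this
    · rw [mem_vanishingIdeal_cartesianSet_iff_of_isHomogeneous (hg.mul hf)]
      intro y hy
      rw [map_mul, hgx y hy]
      by_cases h : y = x
      · simp [h, hfx]
      · simp [h]

end Vanishing

/-! ### Dimension one, and degrees as eventual values of the Hilbert function -/

section Dimension

variable {K : Type*} [Field K] {n : ℕ}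

/-- A quotient of `K[t₀, …, tₙ]` that maps onto the coordinate ring of a line and in which every
variable is integral over `K[t₀]` has dimension one. -/
theorem dimension_eq_one {J : Ideal (MvPolynomial (Fin (n + 1)) K)} (x : Fin n → K)
    (hx : ∀ f ∈ J, lineRestriction x f = 0)
    (hJ : ∀ i, ∃ s : Multiset K, (s.map (linearForm i)).prod ∈ J) : dimension J = 1 := by
  have hle : 1 ≤ ringKrullDim (MvPolynomial (Fin (n + 1)) K ⧸ J) := by
    have h1 : ringKrullDim (Polynomial K) = 1 := by
      rw [Polynomial.ringKrullDim_of_isNoetherianRing, ringKrullDim_eq_zero_of_field, zero_add]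
    rw [← h1]
    refine ringKrullDim_le_of_surjective
      (Ideal.Quotient.lift J (lineRestriction x : _ →+* Polynomial K) hx) ?_
    exact Ideal.Quotient.lift_surjective_of_surjective _ _ (lineRestriction_surjective x)
  have hge : ringKrullDim (MvPolynomial (Fin (n + 1)) K ⧸ J) ≤ 1 := by
    have h1 : ringKrullDim (Polynomial K) = 1 := by
      rw [Polynomial.ringKrullDim_of_isNoetherianRing, ringKrullDim_eq_zero_of_field, zero_add]
    let φ : Polynomial K →ₐ[K] MvPolynomial (Fin (n + 1)) K ⧸ J :=
      (Ideal.Quotient.mkₐ K J).comp (Polynomial.aeval (X 0))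
    have hφX : φ Polynomial.X = Ideal.Quotient.mk J (X 0) := by simp [φ]
    let _ := φ.toRingHom.toAlgebra
    have halg : ∀ p, algebraMap (Polynomial K) (MvPolynomial (Fin (n + 1)) K ⧸ J) p = φ p :=
      fun _ => rfl
    have hint : ∀ i, IsIntegral (Polynomial K) (Ideal.Quotient.mk J (X i)) := by
      intro i
      refine Fin.cases ?_ (fun i => ?_) i
      · rw [← hφX, ← halg]
        exact isIntegral_algebraMap
      · obtain ⟨s, hs⟩ := hJ i
        -- The given element of `J` is the monic polynomial ∏ (T - γ t_0) over K[t_0] evaluated at T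
        -- = t_{i+1}.
        refine ⟨(s.map fun γ => Polynomial.X -
          Polynomial.C (Polynomial.C γ * Polynomial.X : Polynomial K)).prod,
          Polynomial.monic_multiset_prod_of_monic _ _ fun _ _ => Polynomial.monic_X_sub_C _, ?_⟩
        rw [← Polynomial.coe_eval₂RingHom, map_multiset_prod, Multiset.map_map,
          ← Ideal.Quotient.eq_zero_iff_mem.2 hs, map_multiset_prod, Multiset.map_map]
        congr 1
        refine Multiset.map_congr rfl fun γ _ => ?_
        have : φ (Polynomial.C γ) = Ideal.Quotient.mk J (C γ) := by
          simp [φ, MvPolynomial.algebraMap_eq]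
        simp [linearForm, halg, hφX, this]
    have : Algebra.IsIntegral (Polynomial K) (MvPolynomial (Fin (n + 1)) K ⧸ J) := by
      refine ⟨fun y => ?_⟩
      obtain ⟨f, rfl⟩ := Ideal.Quotient.mk_surjective y
      induction f using MvPolynomial.induction_on with
      | C a =>
        have : Ideal.Quotient.mk J (C a) = algebraMap (Polynomial K) _ (Polynomial.C a) := by
          simp [halg, φ, MvPolynomial.algebraMap_eq]
        rw [this]
        exact isIntegral_algebraMap
      | add p q hp hq => rw [map_add]; exact hp.add hq
      | mul_X p i hp => rw [map_mul]; exact hp.mul (hint i)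
    rw [← h1]
    -- Incomparability: along an integral map, strictly nested primes have strictly nested
    -- contractions, so the dimension is at most that of K[t_0].
    refine Order.krullDim_le_of_strictMono
      (PrimeSpectrum.comap (algebraMap (Polynomial K) (MvPolynomial (Fin (n + 1)) K ⧸ J))) ?_
    intro p q hpq
    exact Ideal.IsIntegral.comap_lt_comap (R := Polynomial K) hpq
  rw [dimension, le_antisymm hge hle]
  rfl

/-- In dimension one the factor 0! and the power d^0 both equal 1, so the limit is that of the
Hilbert function itself. -/
theorem degree_eq_of_eventually {J : Ideal (MvPolynomial (Fin (n + 1)) K)} {N : ℕ}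
    (hdim : dimension J = 1) (h : ∀ᶠ d in Filter.atTop, hilbertFunction J d = N) :
    degree J = N := by
  rw [degree, hdim]
  have : Filter.Tendsto (fun d : ℕ => (hilbertFunction J d : ℝ) / (d : ℝ) ^ (1 - 1)) Filter.atTop
      (nhds (N : ℝ)) := by
    refine tendsto_const_nhds.congr' ?_
    filter_upwards [h] with d hd
    simp [hd]
  rw [if_neg one_ne_zero, this.limUnder_eq]
  simp

theorem hilbertFunction_eq_card {σ ι : Type*} [Fintype ι] {J : Ideal (MvPolynomial σ K)} {d : ℕ}
    (L : homogeneousSubmodule σ K d →ₗ[K] (ι → K)) (hL : Function.Surjective L)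
    (hker : ∀ f, L f = 0 ↔ (f : MvPolynomial σ K) ∈ J) :
    hilbertFunction J d = Fintype.card ι := by
  have : (J.restrictScalars K).comap (homogeneousSubmodule σ K d).subtype = LinearMap.ker L := by
    ext f
    simp [hker]
  rw [hilbertFunction, this, (L.quotKerEquivOfSurjective hL).finrank_eq,
    Module.finrank_fintype_fun_eq_card]

open Classical in
/-- If `f` is a form vanishing at some point of `X`, the degree of `S/(I(X), f)` is the number
of zeros of `f` in `X`. -/
theorem degree_vanishingIdeal_sup_span {A : Fin n → Finset K}
    {f : MvPolynomial (Fin (n + 1)) K} {e : ℕ} (hf : f.IsHomogeneous e)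
    (hz : ∃ x ∈ Fintype.piFinset A, eval (chartPoint x) f = 0) :
    degree (vanishingIdeal (cartesianSet A) ⊔ Ideal.span {f}) =
      ((Fintype.piFinset A).filter fun x => eval (chartPoint x) f = 0).card := by
  set J := vanishingIdeal (cartesianSet A) ⊔ Ideal.span {f} with hJdef
  set Y := (Fintype.piFinset A).filter fun x => eval (chartPoint x) f = 0 with hY
  have hJ0 : ∀ x ∈ Y, ∀ h ∈ J, lineRestriction x h = 0 := by
    intro x hx
    rw [hY, Finset.mem_filter] at hx
    have : J ≤ RingHom.ker (lineRestriction x) :=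
      sup_le (fun h hh => mem_vanishingIdeal_cartesianSet_iff.1 hh x hx.1)
        ((Ideal.span_singleton_le_iff_mem _).2
          ((lineRestriction_eq_zero_iff_of_isHomogeneous x hf).2 hx.2))
    exact fun h hh => this hh
  obtain ⟨x₀, hx₀, hfx₀⟩ := hz
  have hdim : dimension J = 1 := by
    refine dimension_eq_one x₀ (hJ0 x₀ (Finset.mem_filter.2 ⟨hx₀, hfx₀⟩)) fun i =>
      ⟨(A i).val, Ideal.mem_sup_left (lineProduct_mem_vanishingIdeal A i)⟩
  refine degree_eq_of_eventually hdim ?_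
  -- Interpolation is needed in degree `d` for surjectivity, and in degree `d - e` for a multiplier
  -- of `f`.
  filter_upwards [Filter.eventually_ge_atTop (∑ i, ((A i).card - 1) + e)] with d hd
  rw [← Fintype.card_coe Y]
  let L : homogeneousSubmodule (Fin (n + 1)) K d →ₗ[K] (Y → K) :=
    LinearMap.pi fun x => (aeval (chartPoint x.1)).toLinearMap ∘ₗ Submodule.subtype _
  have hLapp : ∀ h x, L h x = eval (chartPoint x.1) h.1 := fun h x => by
    simp [L, aeval_eq_eval]
  refine hilbertFunction_eq_card L (fun v => ?_) fun h => ⟨fun hh => ?_, fun hh => ?_⟩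
  · obtain ⟨g, hg, hgv⟩ := exists_isHomogeneous_eval_eq A (le_of_add_le_left hd)
      fun x => if hx : x ∈ Y then v ⟨x, hx⟩ else 0
    refine ⟨⟨g, hg⟩, funext fun x => ?_⟩
    rw [hLapp, hgv x.1 (Finset.mem_filter.1 x.2).1, dif_pos x.2]
  -- The multiplier `g` takes the values h/f. Where `f` vanishes, `h` does too by assumption, so `h
  -- - g * f` vanishes on the whole grid.
  · obtain ⟨g, hg, hgv⟩ := exists_isHomogeneous_eval_eq A (Nat.le_sub_of_add_le hd)
      fun x => eval (chartPoint x) h.1 / eval (chartPoint x) f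
    have hgf : (g * f).IsHomogeneous d := by
      have := hg.mul hf
      rwa [Nat.sub_add_cancel (le_of_add_le_right hd)] at this
    have hsub : h.1 - g * f ∈ vanishingIdeal (cartesianSet A) := by
      refine mem_vanishingIdeal_cartesianSet_of_isHomogeneous (IsHomogeneous.sub h.2 hgf) ?_
      intro x hx
      rw [map_sub, map_mul, hgv x hx]
      by_cases hfx : eval (chartPoint x) f = 0
      · have := congrFun hh ⟨x, Finset.mem_filter.2 ⟨hx, hfx⟩⟩
        rw [hLapp] at this
        simpa [hfx] using this
      · rw [div_mul_cancel₀ _ hfx, sub_self]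
    have := J.add_mem (Ideal.mem_sup_left hsub)
      (Ideal.mem_sup_right (Ideal.mul_mem_left _ g (Ideal.mem_span_singleton_self f)))
    simpa using this
  · refine funext fun x => ?_
    rw [hLapp]
    exact (lineRestriction_eq_zero_iff_of_isHomogeneous x.1 h.2).1 (hJ0 x.1 x.2 _ hh)

end Dimension

/-! ### The box of exponents -/

section Box

variable {K : Type*} {n : ℕ}

/-- An exponent whose coordinates other than the zeroth are smaller than the sizes of the `A i`. -/
def InBox (A : Fin n → Finset K) (a : Fin (n + 1) →₀ ℕ) : Prop :=
  ∀ i : Fin n, a i.succ < (A i).card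

theorem InBox.mono {A : Fin n → Finset K} {a b : Fin (n + 1) →₀ ℕ} (hab : a ≤ b)
    (hb : InBox A b) : InBox A a :=
  fun i => (hab i.succ).trans_lt (hb i)

end Box

/-! ### Normal forms, the initial ideal and its zero-divisor monomials -/

section Footprint

variable {K : Type*} [Field K] {n : ℕ}

theorem degree_eq_of_mem_support {σ : Type*} {f : MvPolynomial σ K} {d : ℕ}
    (hf : f.IsHomogeneous d) {a : σ →₀ ℕ} (ha : a ∈ f.support) : a.degree = d := by
  by_contra h
  exact (mem_support_iff.1 ha) (hf.coeff_eq_zero h)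

theorem degree_eq_add_sum (a : Fin (n + 1) →₀ ℕ) : a.degree = a 0 + ∑ i : Fin n, a i.succ := by
  rw [Finsupp.degree_eq_sum, Fin.sum_univ_succ]

theorem eval_chartPoint_monomial (x : Fin n → K) (a : Fin (n + 1) →₀ ℕ) (c : K) :
    eval (chartPoint x) (monomial a c) = eval x (monomial a.tail c) := by
  rw [eval_monomial, eval_monomial, Finsupp.prod_fintype _ _ (by simp),
    Finsupp.prod_fintype _ _ (by simp), Fin.prod_univ_succ]
  simp [Finsupp.tail_apply]

theorem tail_injOn_degree {a b : Fin (n + 1) →₀ ℕ} (h : a.degree = b.degree)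
    (ht : a.tail = b.tail) : a = b := by
  have h1 : ∀ i : Fin n, a i.succ = b i.succ := fun i => by
    simpa [Finsupp.tail_apply] using DFunLike.congr_fun ht i
  rw [degree_eq_add_sum, degree_eq_add_sum, Finset.sum_congr rfl fun i _ => h1 i] at h
  ext i
  refine Fin.cases ?_ h1 i
  omega

/-- A form with exponents in the box that vanishes on the grid is zero. -/
theorem eq_zero_of_isHomogeneous_of_inBox {A : Fin n → Finset K}
    {f : MvPolynomial (Fin (n + 1)) K} {d : ℕ} (hf : f.IsHomogeneous d)
    (hbox : ∀ a ∈ f.support, InBox A a)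
    (h : ∀ x ∈ Fintype.piFinset A, eval (chartPoint x) f = 0) : f = 0 := by
  classical
  by_contra hne
  obtain ⟨b, hb⟩ := support_nonempty.2 hne
  -- Setting t_0 = 1 gives a polynomial whose degree in each variable is below |A_i|, so vanishing
  -- on the grid makes it zero. No terms merge, because within one degree the tail determines the
  -- exponent.
  let p : MvPolynomial (Fin n) K := ∑ a ∈ f.support, monomial a.tail (coeff a f)
  have hp : p = 0 := by
    refine eq_zero_of_eval_zero_at_prod_finset p A (fun i => ?_) fun x hx => ?_
    · refine (degreeOf_lt_iff ((Nat.zero_le _).trans_lt (hbox b hb i))).2 fun c hc => ?_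
      obtain ⟨a, ha, hca⟩ := Finset.mem_biUnion.1 (support_sum hc)
      rw [Finset.mem_singleton.1 (support_monomial_subset hca), Finsupp.tail_apply]
      exact hbox a ha i
    · rw [← h x (Fintype.mem_piFinset.2 hx)]
      conv_rhs => rw [f.as_sum]
      simp only [p, map_sum, eval_chartPoint_monomial]
  have hcoeff : coeff b.tail p = coeff b f := by
    simp only [p, coeff_sum, coeff_monomial]
    rw [Finset.sum_eq_single b]
    · simp
    · intro a ha hab
      rw [if_neg]
      exact fun ht => hab (tail_injOn_degree ((degree_eq_of_mem_support hf ha).trans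
        (degree_eq_of_mem_support hf hb).symm) ht)
    · exact fun hb' => absurd hb hb'
  rw [hp, coeff_zero] at hcoeff
  exact mem_support_iff.1 hb hcoeff.symm

theorem eq_zero_of_mem_vanishingIdeal_of_inBox {A : Fin n → Finset K}
    {f : MvPolynomial (Fin (n + 1)) K} (hf : f ∈ vanishingIdeal (cartesianSet A))
    (hbox : ∀ a ∈ f.support, InBox A a) : f = 0 := by
  rw [← sum_homogeneousComponent f]
  refine Finset.sum_eq_zero fun e _ => ?_
  have he := homogeneousComponent_isHomogeneous e f
  refine eq_zero_of_isHomogeneous_of_inBox he (fun a ha => hbox a ?_)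
    ((mem_vanishingIdeal_cartesianSet_iff_of_isHomogeneous he).1
      (homogeneousComponent_mem_vanishingIdeal_cartesianSet hf e))
  rw [support_homogeneousComponent] at ha
  exact (Finset.mem_filter.1 ha).1

variable {m : MonomialOrder (Fin (n + 1))}

theorem degree_linearForm
    (hm : ∀ i : Fin n, Finsupp.single 0 1 ≺[m] Finsupp.single i.succ 1) (i : Fin n) (γ : K) :
    m.degree (linearForm i γ) = Finsupp.single i.succ 1 := by
  have hX : m.degree (X i.succ : MvPolynomial (Fin (n + 1)) K) = Finsupp.single i.succ 1 :=
    m.degree_X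
  rw [linearForm, MonomialOrder.degree_sub_of_lt, hX]
  rw [hX, C_mul_X_eq_monomial]
  exact (m.degree_monomial_le γ).trans_lt (hm i)

theorem linearForm_ne_zero (i : Fin n) (γ : K) : linearForm i γ ≠ 0 := by
  intro h
  have := eval_linearForm (fun _ => γ + 1) i γ
  rw [h] at this
  simp at this

theorem lineProduct_ne_zero (i : Fin n) (B : Finset K) : lineProduct i B ≠ 0 :=
  Finset.prod_ne_zero_iff.2 fun _ _ => linearForm_ne_zero _ _

theorem degree_lineProduct
    (hm : ∀ i : Fin n, Finsupp.single 0 1 ≺[m] Finsupp.single i.succ 1) (i : Fin n)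
    (B : Finset K) : m.degree (lineProduct i B) = Finsupp.single i.succ B.card := by
  rw [lineProduct, MonomialOrder.degree_prod fun _ _ => linearForm_ne_zero _ _]
  simp [degree_linearForm hm]

/-- Every polynomial is congruent modulo `I(X)` to one supported in the box; the leading term
survives if it lies in the box. -/
theorem exists_normalForm
    (hm : ∀ i : Fin n, Finsupp.single 0 1 ≺[m] Finsupp.single i.succ 1)
    (A : Fin n → Finset K) (f : MvPolynomial (Fin (n + 1)) K) :
    ∃ r, f - r ∈ vanishingIdeal (cartesianSet A) ∧ (∀ a ∈ r.support, InBox A a) ∧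
      (InBox A (m.degree f) → coeff (m.degree f) r = m.leadingCoeff f) := by
  obtain ⟨g, r, hfr, hg, hr⟩ := m.div (b := fun i => lineProduct i (A i))
    (fun i => (MonomialOrder.leadingCoeff_ne_zero_iff.2 (lineProduct_ne_zero i (A i))).isUnit) f
  rw [Finsupp.linearCombination_apply, Finsupp.sum] at hfr
  refine ⟨r, ?_, fun a ha i => ?_, fun hbox => ?_⟩
  · rw [hfr, add_sub_cancel_right]
    exact Ideal.sum_mem _ fun i _ =>
      Ideal.mul_mem_left _ _ (lineProduct_mem_vanishingIdeal A i)
  · have := hr a ha i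
    rw [degree_lineProduct hm, Finsupp.single_le_iff] at this
    exact not_le.1 this
  -- A product in the division whose leading exponent is that of `f` would force the latter to be at
  -- least |A_i| in coordinate `i.succ`, outside the box.
  · have hz : ∀ i ∈ g.support, coeff (m.degree f) (g i • lineProduct i (A i)) = 0 := by
      intro i hi
      rw [smul_eq_mul, mul_comm]
      refine MonomialOrder.coeff_eq_zero_of_lt (m := m) (lt_of_le_of_ne (hg i) fun h => ?_)
      have h := m.toSyn.injective h
      rw [MonomialOrder.degree_mul (lineProduct_ne_zero i _) (Finsupp.mem_support_iff.1 hi),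
        degree_lineProduct hm] at h
      have h1 := hbox i
      rw [← h] at h1
      simp at h1
    have := congrArg (coeff (m.degree f)) hfr
    rw [coeff_add, coeff_sum, Finset.sum_eq_zero hz, zero_add] at this
    exact this.symm

/-- This is the Gröbner basis property of the `lineProduct i (A i)`. A leading exponent in the box
would survive in the normal form, which is zero because it lies both in I(X) and in the span of the
box. -/
theorem exists_card_le_degree_of_mem_vanishingIdeal
    (hm : ∀ i : Fin n, Finsupp.single 0 1 ≺[m] Finsupp.single i.succ 1)
    {A : Fin n → Finset K} {f : MvPolynomial (Fin (n + 1)) K}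
    (hf : f ∈ vanishingIdeal (cartesianSet A)) (hf0 : f ≠ 0) : ¬ InBox A (m.degree f) := by
  intro hbox
  obtain ⟨r, hfr, hr, hlead⟩ := exists_normalForm hm A f
  have hr0 : r = 0 := by
    refine eq_zero_of_mem_vanishingIdeal_of_inBox ?_ hr
    simpa using (vanishingIdeal (cartesianSet A)).sub_mem hf hfr
  have := hlead hbox
  rw [hr0, coeff_zero] at this
  exact MonomialOrder.leadingCoeff_ne_zero_iff.2 hf0 this.symm

theorem initialIdeal_vanishingIdeal
    (hm : ∀ i : Fin n, Finsupp.single 0 1 ≺[m] Finsupp.single i.succ 1)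
    (A : Fin n → Finset K) :
    initialIdeal m (vanishingIdeal (cartesianSet A)) =
      Ideal.span ((fun a => monomial a (1 : K)) '' {a | ¬ InBox A a}) := by
  refine le_antisymm (Ideal.span_mono ?_) (Ideal.span_le.2 ?_)
  · rintro p ⟨f, hf, hf0, rfl⟩
    exact ⟨_, exists_card_le_degree_of_mem_vanishingIdeal hm hf hf0, rfl⟩
  · rintro p ⟨a, ha, rfl⟩
    obtain ⟨i, hi⟩ := not_forall.1 ha
    have hmem : monomial (Finsupp.single i.succ (A i).card) (1 : K) ∈
        initialIdeal m (vanishingIdeal (cartesianSet A)) :=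
      Ideal.subset_span ⟨lineProduct i (A i), lineProduct_mem_vanishingIdeal A i,
        lineProduct_ne_zero i _, by rw [degree_lineProduct hm]⟩
    refine Ideal.mem_of_dvd _ (monomial_dvd_monomial.2 ⟨Or.inr ?_, dvd_rfl⟩) hmem
    exact Finsupp.single_le_iff.2 (not_lt.1 hi)

theorem mem_initialIdeal_iff
    (hm : ∀ i : Fin n, Finsupp.single 0 1 ≺[m] Finsupp.single i.succ 1)
    {A : Fin n → Finset K} {f : MvPolynomial (Fin (n + 1)) K} :
    f ∈ initialIdeal m (vanishingIdeal (cartesianSet A)) ↔ ∀ a ∈ f.support, ¬ InBox A a := by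
  rw [initialIdeal_vanishingIdeal hm, mem_ideal_span_monomial_image]
  exact forall₂_congr fun a _ => ⟨fun ⟨b, hb, hba⟩ ha => hb (ha.mono hba), fun h => ⟨a, h, le_rfl⟩⟩

theorem mem_footprint_iff
    (hm : ∀ i : Fin n, Finsupp.single 0 1 ≺[m] Finsupp.single i.succ 1)
    {A : Fin n → Finset K} {a : Fin (n + 1) →₀ ℕ} :
    a ∈ footprint m (vanishingIdeal (cartesianSet A)) ↔ InBox A a := by
  simp [footprint, mem_initialIdeal_iff hm]

/-- The box puts no condition on the exponent of t_0, so powers of t_0 are regular. A monomial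
divisible by t_{i+1} is killed by t_{i+1}^{|A_i| - 1}, which is nonzero in the quotient because
every A_j is nonempty. -/
theorem isZeroDivisorMod_initialIdeal_iff
    (hm : ∀ i : Fin n, Finsupp.single 0 1 ≺[m] Finsupp.single i.succ 1)
    {A : Fin n → Finset K} (hpos : ∀ i, 1 ≤ (A i).card) {a : Fin (n + 1) →₀ ℕ} :
    IsZeroDivisorMod (initialIdeal m (vanishingIdeal (cartesianSet A))) (monomial a (1 : K)) ↔
      ∃ i : Fin n, a i.succ ≠ 0 := by
  constructor
  · rintro ⟨g, hg, hga⟩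
    by_contra! h
    refine hg ((mem_initialIdeal_iff hm).2 fun b hb hbox => ?_)
    refine (mem_initialIdeal_iff hm).1 hga (b + a) ?_ fun i => ?_
    · rw [mem_support_iff, coeff_mul_monomial, mul_one]
      exact mem_support_iff.1 hb
    · simpa [h i] using hbox i
  · rintro ⟨i, hi⟩
    refine ⟨monomial (Finsupp.single i.succ ((A i).card - 1)) 1, fun h => ?_, ?_⟩
    · refine (mem_initialIdeal_iff hm).1 h (Finsupp.single i.succ ((A i).card - 1))
        (mem_support_iff.2 (by rw [coeff_monomial, if_pos rfl]; exact one_ne_zero)) fun j => ?_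
      by_cases hj : j = i
      · subst hj
        simpa using hpos j
      · rw [Finsupp.single_eq_of_ne (by simpa using hj)]
        exact hpos j
    · rw [monomial_mul, mem_initialIdeal_iff hm]
      intro b hb hbox
      rw [Finset.mem_singleton.1 (support_monomial_subset hb)] at hbox
      have := hbox i
      simp only [Finsupp.add_apply, Finsupp.single_eq_same] at this
      omega

end Footprint

/-! ### Degrees for the initial ideal, the footprint bound and its sharpness -/

section Degrees

variable {K : Type*} [Field K] {n : ℕ} {m : MonomialOrder (Fin (n + 1))}

/-- The exponent of degree `d` with the given coordinates other than the zeroth. -/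
def homogenizedExponent (d : ℕ) (c : Fin n → ℕ) : Fin (n + 1) →₀ ℕ :=
  Finsupp.cons (d - ∑ i, c i) (Finsupp.equivFunOnFinite.symm c)

@[simp]
theorem homogenizedExponent_succ (d : ℕ) (c : Fin n → ℕ) (i : Fin n) :
    homogenizedExponent d c i.succ = c i := by
  simp [homogenizedExponent]

@[simp]
theorem homogenizedExponent_zero (d : ℕ) (c : Fin n → ℕ) :
    homogenizedExponent d c 0 = d - ∑ i, c i := by
  simp [homogenizedExponent]

theorem degree_homogenizedExponent {d : ℕ} {c : Fin n → ℕ} (h : ∑ i, c i ≤ d) :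
    (homogenizedExponent d c).degree = d := by
  rw [degree_eq_add_sum]
  simp [Nat.sub_add_cancel h]

theorem homogenizedExponent_injective (d : ℕ) :
    Function.Injective (homogenizedExponent d : (Fin n → ℕ) → _) := by
  intro c c' h
  funext i
  simpa using DFunLike.congr_fun h i.succ

theorem homogenizedExponent_of_degree_eq {a : Fin (n + 1) →₀ ℕ} {d : ℕ} (ha : a.degree = d) :
    homogenizedExponent d (fun i => a i.succ) = a := by
  ext i
  refine Fin.cases ?_ (fun i => ?_) i
  · rw [homogenizedExponent_zero, ← ha, degree_eq_add_sum, Nat.add_sub_cancel]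
  · simp

theorem sum_le_sum_sub_one {k c : Fin n → ℕ} (hc : ∀ i, c i < k i) :
    ∑ i, c i ≤ ∑ i, (k i - 1) :=
  Finset.sum_le_sum fun i _ => Nat.le_sub_one_of_lt (hc i)

open Classical in
/-- The number of exponents in the box that do not dominate `a`. -/
theorem card_filter_not_le (k a : Fin n → ℕ) :
    ((Fintype.piFinset fun i => Finset.range (k i)).filter fun c => ¬ a ≤ c).card +
      ∏ i, (k i - a i) = ∏ i, k i := by
  classical
  have h : (Fintype.piFinset fun i => Finset.range (k i)).filter (fun c => a ≤ c) =
      Fintype.piFinset fun i => Finset.Ico (a i) (k i) := by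
    ext c
    simp only [Finset.mem_filter, Fintype.mem_piFinset, Finset.mem_range, Finset.mem_Ico,
      Pi.le_def]
    exact ⟨fun h i => ⟨h.2 i, h.1 i⟩, fun h => ⟨fun i => (h i).2, fun i => (h i).1⟩⟩
  -- Truncated subtraction is harmless: if some a_i ≥ k_i, the interval is empty and the product is
  -- 0.
  have := Finset.card_filter_add_card_filter_not
    (s := Fintype.piFinset fun i => Finset.range (k i)) (fun c => a ≤ c)
  rw [h, Fintype.card_piFinset, Fintype.card_piFinset] at this
  simp only [Nat.card_Ico, Finset.card_range] at this
  omega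

/-- The degree of the quotient by the initial ideal and one more monomial. -/
theorem degree_initialIdeal_sup_span
    (hm : ∀ i : Fin n, Finsupp.single 0 1 ≺[m] Finsupp.single i.succ 1)
    {A : Fin n → Finset K} (hpos : ∀ i, 1 ≤ (A i).card) {a : Fin (n + 1) →₀ ℕ}
    (ha : ∃ i : Fin n, a i.succ ≠ 0) :
    degree (initialIdeal m (vanishingIdeal (cartesianSet A)) ⊔
      Ideal.span {monomial a (1 : K)}) =
      (∏ i, (A i).card : ℕ) - (∏ i, ((A i).card - a i.succ) : ℕ) := by
  classical
  set J := initialIdeal m (vanishingIdeal (cartesianSet A)) ⊔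
    Ideal.span {monomial a (1 : K)} with hJdef
  have hJ : ∀ f, f ∈ J ↔ ∀ b ∈ f.support, ¬ InBox A b ∨ a ≤ b := by
    intro f
    rw [hJdef, initialIdeal_vanishingIdeal hm, ← Ideal.span_union,
      ← Set.image_singleton (f := fun a => monomial a (1 : K)), ← Set.image_union,
      mem_ideal_span_monomial_image]
    refine forall₂_congr fun b _ => ⟨?_, ?_⟩
    · rintro ⟨c, hc | rfl, hcb⟩
      · exact Or.inl fun hb => hc (hb.mono hcb)
      · exact Or.inr hcb
    · rintro (hb | hb)
      · exact ⟨b, Or.inl hb, le_rfl⟩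
      · exact ⟨a, Or.inr rfl, hb⟩
  have hdim : dimension J = 1 := by
    -- Every monomial of `J` contains some t_{i+1}, so `J` vanishes on the line through (1, 0, …,
    -- 0). With all roots γ = 0 the required product is t_{i+1}^{|A_i|}.
    refine dimension_eq_one 0 (fun f hf => ?_)
      fun i => ⟨Multiset.replicate (A i).card 0, (hJ _).2 fun b hb => Or.inl fun hbox => ?_⟩
    · rw [f.as_sum, map_sum]
      refine Finset.sum_eq_zero fun b hb => ?_
      have : ∃ i : Fin n, b i.succ ≠ 0 := by
        rcases (hJ f).1 hf b hb with h | h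
        · obtain ⟨i, hi⟩ := not_forall.1 h
          have := hpos i
          exact ⟨i, by omega⟩
        · obtain ⟨i, hi⟩ := ha
          have := h i.succ
          exact ⟨i, by omega⟩
      obtain ⟨i, hi⟩ := this
      have : eval (chartPoint (0 : Fin n → K)) (monomial b (coeff b f)) = 0 := by
        rw [eval_chartPoint_monomial, eval_monomial, Finsupp.prod_fintype _ _ (by simp),
          Finset.prod_eq_zero (Finset.mem_univ i), mul_zero]
        simpa [Finsupp.tail_apply] using hi
      rw [lineRestriction_monomial, this, map_zero, zero_mul]
    · have h1 : (Multiset.map (linearForm i) (Multiset.replicate (A i).card (0 : K))).prod =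
          monomial (Finsupp.single i.succ (A i).card) 1 := by
        simp [linearForm, X_pow_eq_monomial]
      rw [h1] at hb
      rw [Finset.mem_singleton.1 (support_monomial_subset hb)] at hbox
      simpa using hbox i
  set Y := (Fintype.piFinset fun i => Finset.range (A i).card).filter
    fun c => ¬ (fun i : Fin n => a i.succ) ≤ c with hY
  have hYbox : ∀ c ∈ Y, ∀ i, c i < (A i).card := fun c hc i =>
    Finset.mem_range.1 (Fintype.mem_piFinset.1 (Finset.mem_filter.1 hc).1 i)
  have hcard := card_filter_not_le (fun i => (A i).card) fun i => a i.succ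
  rw [← hY] at hcard
  rw [← hcard, Nat.cast_add, add_sub_cancel_right]
  refine degree_eq_of_eventually hdim ?_
  -- The summand `a 0` ensures that every box exponent of degree `d` has zeroth coordinate at least
  -- `a 0`, so divisibility by t^a depends only on the other coordinates.
  filter_upwards [Filter.eventually_ge_atTop (∑ i, ((A i).card - 1) + a 0)] with d hd
  rw [← Fintype.card_coe Y]
  have hsum : ∀ c : Fin n → ℕ, (∀ i, c i < (A i).card) → ∑ i, c i + a 0 ≤ d := fun c hc =>
    (Nat.add_le_add_right (sum_le_sum_sub_one hc) _).trans hd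
  let L : homogeneousSubmodule (Fin (n + 1)) K d →ₗ[K] (Y → K) :=
    LinearMap.pi fun c => lcoeff K (homogenizedExponent d c.1) ∘ₗ Submodule.subtype _
  have hLapp : ∀ h c, L h c = coeff (homogenizedExponent d c.1) h.1 := fun h c => rfl
  refine hilbertFunction_eq_card L (fun v => ?_) fun h => ⟨fun hh => ?_, fun hh => ?_⟩
  · refine ⟨⟨∑ c, monomial (homogenizedExponent d c.1) (v c),
      IsHomogeneous.sum _ _ _ fun c _ => isHomogeneous_monomial _
        (degree_homogenizedExponent (le_of_add_le_left (hsum c.1 (hYbox c.1 c.2))))⟩,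
      funext fun c => ?_⟩
    rw [hLapp]
    simp only [coeff_sum, coeff_monomial, (homogenizedExponent_injective d).eq_iff,
      Subtype.coe_inj, Finset.sum_ite_eq', Finset.mem_univ, if_true]
  · refine (hJ _).2 fun b hb => ?_
    by_contra! hb'
    obtain ⟨hbox, hab⟩ := hb'
    have hbd : b.degree = d := degree_eq_of_mem_support h.2 hb
    have hbeq := homogenizedExponent_of_degree_eq hbd
    have hbY : (fun i : Fin n => b i.succ) ∈ Y := by
      refine Finset.mem_filter.2 ⟨Fintype.mem_piFinset.2 fun i => Finset.mem_range.2 (hbox i),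
        fun hle => hab fun i => ?_⟩
      refine Fin.cases ?_ hle i
      have h1 := hsum _ hbox
      rw [degree_eq_add_sum] at hbd
      omega
    have := congrFun hh ⟨_, hbY⟩
    rw [hLapp, hbeq] at this
    exact mem_support_iff.1 hb this
  · refine funext fun c => ?_
    rw [hLapp]
    by_contra hne
    rcases (hJ _).1 hh _ (mem_support_iff.2 hne) with h1 | h1
    · exact h1 fun i => by simpa using hYbox c.1 c.2 i
    · exact (Finset.mem_filter.1 c.2).2 fun i => by simpa using h1 i.succ

open Classical in
/-- The footprint bound: a form with leading exponent `a` has at least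
`∏ (|A i| - a i)` nonzeros in the grid. -/
theorem prod_sub_le_card_nonzeros
    (hm : ∀ i : Fin n, Finsupp.single 0 1 ≺[m] Finsupp.single i.succ 1)
    {A : Fin n → Finset K} {f : MvPolynomial (Fin (n + 1)) K} {e : ℕ}
    (hf : f.IsHomogeneous e) (hf0 : f ≠ 0) :
    ∏ i : Fin n, ((A i).card - m.degree f i.succ) ≤
      ((Fintype.piFinset A).filter fun x => eval (chartPoint x) f ≠ 0).card := by
  set a := m.degree f with ha
  set Z := (Fintype.piFinset A).filter fun x => eval (chartPoint x) f ≠ 0 with hZ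
  -- The shifts `c` that keep `a + c` in the box. If `a` is already outside, `S` is empty and the
  -- bound is trivial.
  set S := Fintype.piFinset fun i : Fin n => Finset.range ((A i).card - a i.succ) with hS
  have hSc : S.card = ∏ i : Fin n, ((A i).card - a i.succ) := by
    simp [hS, Fintype.card_piFinset]
  set N := ∑ i, ((A i).card - 1) with hN
  have hSlt : ∀ c ∈ S, ∀ i, c i + a i.succ < (A i).card := fun c hc i => by
    have := Finset.mem_range.1 (Fintype.mem_piFinset.1 hc i)
    omega
  have hSN : ∀ c ∈ S, ∑ i, c i ≤ N := fun c hc =>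
    sum_le_sum_sub_one fun i => (Nat.le_add_right _ _).trans_lt (hSlt c hc i)
  let G : (S → K) →ₗ[K] MvPolynomial (Fin (n + 1)) K :=
    Fintype.linearCombination K fun c : S => monomial (homogenizedExponent N c.1) (1 : K)
  have hGapp : ∀ l, G l = ∑ c : S, monomial (homogenizedExponent N c.1) (l c) := fun l => by
    simp [G, Fintype.linearCombination_apply, smul_monomial]
  have hGhom : ∀ l, (G l).IsHomogeneous N := fun l => by
    rw [hGapp]
    exact IsHomogeneous.sum _ _ _ fun c _ => isHomogeneous_monomial _
      (degree_homogenizedExponent (hSN c.1 c.2))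
  have hGcoeff : ∀ l (c : S), coeff (homogenizedExponent N c.1) (G l) = l c := fun l c => by
    rw [hGapp]
    simp only [coeff_sum, coeff_monomial, (homogenizedExponent_injective N).eq_iff,
      Subtype.coe_inj, Finset.sum_ite_eq', Finset.mem_univ, if_true]
  let Φ : (S → K) →ₗ[K] (Z → K) :=
    (LinearMap.pi fun x : Z => (aeval (chartPoint x.1)).toLinearMap ∘ₗ
      LinearMap.mulRight K f) ∘ₗ G
  have hΦapp : ∀ l x, Φ l x = eval (chartPoint x.1) (G l * f) := fun l x => by
    simp [Φ, aeval_eq_eval]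
  -- If all values on `Z` vanish, `G l * f` lies in I(X). Unless `G l = 0`, its leading exponent is
  -- `a` plus a shift from `S`, hence in the box, which is impossible. So |S| ≤ |Z|.
  have hinj : Function.Injective Φ := by
    refine (injective_iff_map_eq_zero Φ).2 fun l hl => ?_
    have hmem : G l * f ∈ vanishingIdeal (cartesianSet A) := by
      refine mem_vanishingIdeal_cartesianSet_of_isHomogeneous ((hGhom l).mul hf) fun x hx => ?_
      by_cases hfx : eval (chartPoint x) f = 0
      · simp [hfx]
      · rw [← hΦapp l ⟨x, Finset.mem_filter.2 ⟨hx, hfx⟩⟩, hl]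
        rfl
    have hG0 : G l = 0 := by
      by_contra hne
      refine exists_card_le_degree_of_mem_vanishingIdeal hm hmem (mul_ne_zero hne hf0) fun i => ?_
      rw [MonomialOrder.degree_mul hne hf0]
      have hlead := m.degree_mem_support hne
      rw [hGapp] at hlead
      obtain ⟨c, -, hc⟩ := Finset.mem_biUnion.1 (support_sum hlead)
      rw [← hGapp] at hc
      rw [Finset.mem_singleton.1 (support_monomial_subset hc)]
      simpa using hSlt c.1 c.2 i
    funext c
    rw [← hGcoeff l c, hG0]
    rfl
  have := LinearMap.finrank_le_finrank_of_injective hinj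
  rwa [Module.finrank_fintype_fun_eq_card, Module.finrank_fintype_fun_eq_card, Fintype.card_coe,
    Fintype.card_coe, hSc] at this

theorem degreeOf_linearForm_le [DecidableEq (Fin n)] (i j : Fin n) (γ : K) :
    degreeOf i.succ (linearForm j γ) ≤ if i = j then 1 else 0 := by
  refine (degreeOf_sub_le _ _ _).trans (max_le ?_ ?_)
  · rw [degreeOf_X]
    simp
  · refine (degreeOf_mul_le _ _ _).trans ?_
    rw [degreeOf_C, degreeOf_X]
    simp

theorem apply_succ_le_card_of_mem_support_boxProduct {e : ℕ} {B : Fin n → Finset K}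
    {a : Fin (n + 1) →₀ ℕ} (ha : a ∈ (boxProduct e B).support) (i : Fin n) :
    a i.succ ≤ (B i).card := by
  refine (monomial_le_degreeOf i.succ ha).trans ((degreeOf_mul_le _ _ _).trans ?_)
  have h0 : degreeOf i.succ (X 0 ^ e : MvPolynomial (Fin (n + 1)) K) = 0 := by
    rw [X_pow_eq_monomial, degreeOf_monomial_eq _ _ one_ne_zero]
    simp
  rw [h0, zero_add]
  refine (degreeOf_prod_le _ _ _).trans ?_
  have h1 : ∀ j, degreeOf i.succ (lineProduct j (B j)) ≤ if i = j then (B j).card else 0 := by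
    intro j
    refine (degreeOf_prod_le _ _ _).trans
      ((Finset.sum_le_sum fun γ _ => degreeOf_linearForm_le i j γ).trans ?_)
    split_ifs <;> simp
  refine (Finset.sum_le_sum fun j _ => h1 j).trans ?_
  simp

open Classical in
/-- The footprint bound is attained. -/
theorem exists_form_card_nonzeros_eq (A : Fin n → Finset K) {a : Fin (n + 1) →₀ ℕ}
    (hbox : InBox A a) :
    ∃ f : MvPolynomial (Fin (n + 1)) K, f.IsHomogeneous a.degree ∧
      (∀ b ∈ f.support, InBox A b) ∧
      ((Fintype.piFinset A).filter fun x => eval (chartPoint x) f ≠ 0).card =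
        ∏ i : Fin n, ((A i).card - a i.succ) := by
  -- Taking a_{i+1} roots from each A_i leaves as nonzeros exactly the grid ∏ (A_i \ B_i).
  choose B hBA hBc using fun i => Finset.exists_subset_card_eq (hbox i).le
  refine ⟨boxProduct (a 0) B, ?_, fun b hb i => ?_, ?_⟩
  · have := isHomogeneous_boxProduct (a 0) B
    simpa only [hBc, ← degree_eq_add_sum] using this
  · exact (apply_succ_le_card_of_mem_support_boxProduct hb i).trans_lt (hBc i ▸ hbox i)
  · have : (Fintype.piFinset A).filter (fun x => eval (chartPoint x) (boxProduct (a 0) B) ≠ 0) =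
        Fintype.piFinset fun i => A i \ B i := by
      ext x
      simp only [Finset.mem_filter, Fintype.mem_piFinset, Ne, eval_boxProduct_eq_zero_iff,
        not_exists, Finset.mem_sdiff, forall_and]
    rw [this, Fintype.card_piFinset]
    exact Finset.prod_congr rfl fun i _ => by
      rw [Finset.card_sdiff_of_subset (hBA i), hBc]

end Degrees

/-! ### Equality of the minimum distance and footprint functions -/

section GeilCarvalho

variable {K : Type*} [Field K] {n : ℕ} {m : MonomialOrder (Fin (n + 1))}

/-- Replacing each variable of a monomial by t_0 can only lower it. -/
theorem single_zero_degree_le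
    (hm : ∀ i : Fin n, Finsupp.single 0 1 ≺[m] Finsupp.single i.succ 1) (b : Fin (n + 1) →₀ ℕ) :
    Finsupp.single 0 b.degree ≼[m] b := by
  induction b using Finsupp.induction_linear with
  | zero => simp
  | add f g hf hg =>
    rw [map_add, Finsupp.single_add, map_add, map_add]
    exact add_le_add hf hg
  | single i k =>
    have h1 : ∀ j : Fin (n + 1), Finsupp.single j k = k • Finsupp.single j 1 := fun j => by simp
    rw [Finsupp.degree_single, h1, h1, map_nsmul, map_nsmul]
    refine nsmul_le_nsmul_right ?_ k
    refine Fin.cases le_rfl (fun i => (hm i).le) i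

/-- A power of t_0 is the least monomial of its degree. Were it leading, `f` would be a nonzero
scalar multiple of it and could not vanish on the chart. So leading monomials of zero-divisors are
zero-divisors modulo the initial ideal. -/
theorem exists_degree_apply_succ_ne_zero
    (hm : ∀ i : Fin n, Finsupp.single 0 1 ≺[m] Finsupp.single i.succ 1)
    {f : MvPolynomial (Fin (n + 1)) K} {d : ℕ} (hf : f.IsHomogeneous d) (hf0 : f ≠ 0)
    {x : Fin n → K} (hx : eval (chartPoint x) f = 0) : ∃ i : Fin n, m.degree f i.succ ≠ 0 := by
  by_contra! h
  have hsupp : ∀ b ∈ f.support, b = m.degree f := by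
    intro b hb
    have hdeg : (m.degree f).degree = d := degree_eq_of_mem_support hf (m.degree_mem_support hf0)
    have hlead : m.degree f = Finsupp.single 0 b.degree := by
      rw [degree_eq_of_mem_support hf hb, ← hdeg, degree_eq_add_sum]
      ext i
      refine Fin.cases (by simp [h]) (fun i => by simp [h]) i
    refine m.toSyn.injective (le_antisymm (m.le_degree hb) ?_)
    rw [hlead]
    exact single_zero_degree_le hm b
  rw [f.as_sum, Finset.sum_eq_single_of_mem _ (m.degree_mem_support hf0)
    fun b hb hne => absurd (hsupp b hb) hne, eval_monomial, Finsupp.prod_fintype _ _ (by simp),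
    Fin.prod_univ_succ] at hx
  simp only [Fin.cons_zero, one_pow, h, pow_zero, Finset.prod_const_one, mul_one] at hx
  exact m.leadingCoeff_ne_zero_iff.2 hf0 hx

open Classical in
theorem card_zeros_eq_sub (A : Fin n → Finset K) (f : MvPolynomial (Fin (n + 1)) K) :
    (((Fintype.piFinset A).filter fun x => eval (chartPoint x) f = 0).card : ℝ) =
      (∏ i, (A i).card : ℕ) -
        ((Fintype.piFinset A).filter fun x => eval (chartPoint x) f ≠ 0).card := by
  rw [← Fintype.card_piFinset, eq_sub_iff_add_eq, ← Nat.cast_add,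
    Finset.card_filter_add_card_filter_not]

theorem isHomogeneous_of_forall_mem_support {σ : Type*} {f : MvPolynomial σ K} {d : ℕ}
    (h : ∀ a ∈ f.support, a.degree = d) : f.IsHomogeneous d := by
  rw [f.as_sum]
  exact IsHomogeneous.sum _ _ _ fun a ha => isHomogeneous_monomial _ (h a ha)

/-- For a monomial order in which `t₀` is the smallest variable, the minimum distance function
and the footprint function of the vanishing ideal of a Cartesian set coincide. -/
theorem minDistFunction_eq_footprintFunction
    (hm : ∀ i : Fin n, Finsupp.single 0 1 ≺[m] Finsupp.single i.succ 1)
    {A : Fin n → Finset K} (hpos : ∀ i, 1 ≤ (A i).card) (d : ℕ) :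
    minDistFunction m (vanishingIdeal (cartesianSet A)) d =
      footprintFunction m (vanishingIdeal (cartesianSet A)) d := by
  classical
  set I := vanishingIdeal (cartesianSet A) with hI
  have hM : ∀ a, a ∈ zeroDivisorMonomials m I d ↔
      InBox A a ∧ a.degree = d ∧ ∃ i : Fin n, a i.succ ≠ 0 := fun a => by
    rw [zeroDivisorMonomials, Set.mem_ofPred_eq, mem_footprint_iff hm,
      isZeroDivisorMod_initialIdeal_iff hm hpos]
  have hMF : ∀ a ∈ zeroDivisorMonomials m I d, ∃ f ∈ zeroDivisorPolynomials m I d,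
      degree (I ⊔ Ideal.span {f}) =
        degree (initialIdeal m I ⊔ Ideal.span {monomial a (1 : K)}) := by
    intro a ha
    obtain ⟨hbox, hdeg, i, hi⟩ := (hM a).1 ha
    obtain ⟨f, hf, hsupp, hcard⟩ := exists_form_card_nonzeros_eq A hbox
    -- The nonzero exponent at `i.succ` makes the number of nonzeros smaller than the grid, so `f`
    -- has a zero there and is a zero-divisor.
    have hlt : ∏ i : Fin n, ((A i).card - a i.succ) < ∏ i, (A i).card :=
      Finset.prod_lt_prod (fun j _ => Nat.sub_pos_of_lt (hbox j)) (fun j _ => Nat.sub_le _ _)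
        ⟨i, Finset.mem_univ i, Nat.sub_lt (hpos i) (Nat.pos_of_ne_zero hi)⟩
    have hz : ∃ x ∈ Fintype.piFinset A, eval (chartPoint x) f = 0 := by
      by_contra! h
      rw [Finset.filter_true_of_mem h, Fintype.card_piFinset] at hcard
      omega
    have hf0 : f ≠ 0 := by
      rintro rfl
      have : 0 < ∏ i : Fin n, ((A i).card - a i.succ) :=
        Finset.prod_pos fun j _ => Nat.sub_pos_of_lt (hbox j)
      rw [← hcard] at this
      simp at this
    refine ⟨f, ⟨hf0, fun b hb => ⟨(mem_footprint_iff hm).2 (hsupp b hb),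
      (degree_eq_of_mem_support hf hb).trans hdeg⟩,
      (isZeroDivisorMod_vanishingIdeal_iff hf).2 hz⟩, ?_⟩
    rw [degree_vanishingIdeal_sup_span hf hz, degree_initialIdeal_sup_span hm hpos ⟨i, hi⟩,
      card_zeros_eq_sub, hcard]
  have hFM : ∀ f ∈ zeroDivisorPolynomials m I d, ∃ a ∈ zeroDivisorMonomials m I d,
      degree (I ⊔ Ideal.span {f}) ≤
        degree (initialIdeal m I ⊔ Ideal.span {monomial a (1 : K)}) := by
    rintro f ⟨hf0, hsupp, hzd⟩
    have hf := isHomogeneous_of_forall_mem_support fun a ha => (hsupp a ha).2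
    have hz := (isZeroDivisorMod_vanishingIdeal_iff hf).1 hzd
    obtain ⟨x, -, hx⟩ := id hz
    have hlead := m.degree_mem_support hf0
    have hne := exists_degree_apply_succ_ne_zero hm hf hf0 hx
    refine ⟨m.degree f, (hM _).2 ⟨(mem_footprint_iff hm).1 (hsupp _ hlead).1,
      (hsupp _ hlead).2, hne⟩, ?_⟩
    rw [degree_vanishingIdeal_sup_span hf hz, degree_initialIdeal_sup_span hm hpos hne,
      card_zeros_eq_sub]
    exact sub_le_sub_left (Nat.cast_le.2 (prod_sub_le_card_nonzeros hm hf hf0)) _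
  -- Both sets are empty together, so the default values of the two functions agree as well.
  have hne : (zeroDivisorPolynomials m I d).Nonempty ↔ (zeroDivisorMonomials m I d).Nonempty :=
    ⟨fun ⟨f, hf⟩ => (hFM f hf).imp fun _ h => h.1, fun ⟨a, ha⟩ => (hMF a ha).imp fun _ h => h.1⟩
  rw [minDistFunction, footprintFunction]
  by_cases h : (zeroDivisorMonomials m I d).Nonempty
  · rw [if_pos (hne.2 h), if_pos h]
    congr 1
    have hbdd : BddAbove ((fun a : Fin (n + 1) →₀ ℕ =>
        degree (initialIdeal m I ⊔ Ideal.span {monomial a (1 : K)})) ''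
          zeroDivisorMonomials m I d) := by
      refine ⟨(∏ i, (A i).card : ℕ), ?_⟩
      rintro _ ⟨a, ha, rfl⟩
      simp only [degree_initialIdeal_sup_span hm hpos ((hM a).1 ha).2.2, hI]
      exact sub_le_self _ (Nat.cast_nonneg _)
    refine le_antisymm (csSup_le ((hne.2 h).image _) ?_) (csSup_le (h.image _) ?_)
    · rintro _ ⟨f, hf, rfl⟩
      obtain ⟨a, ha, hle⟩ := hFM f hf
      exact hle.trans (le_csSup hbdd ⟨a, ha, rfl⟩)
    · rintro _ ⟨a, ha, rfl⟩
      obtain ⟨f, hf, heq⟩ := hMF a ha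
      refine le_csSup ?_ ⟨f, hf, heq⟩
      obtain ⟨M, hMb⟩ := hbdd
      refine ⟨M, ?_⟩
      rintro _ ⟨f, hf, rfl⟩
      obtain ⟨a, ha, hle⟩ := hFM f hf
      exact hle.trans (hMb ⟨a, ha, rfl⟩)
  · rw [if_neg (mt hne.1 h), if_neg h]

/-- The graded lexicographic order in which `t₀` is the smallest variable. -/
def reverseDegLex (n : ℕ) : MonomialOrder (Fin (n + 1)) where
  syn := (MonomialOrder.degLex (σ := Fin (n + 1))).syn
  -- In `degLex` the variable of index 0 is the largest; reversing the indices makes it the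
  -- smallest.
  toSyn := (Finsupp.domCongr Fin.revPerm).trans MonomialOrder.degLex.toSyn
  toSyn_monotone a b h := by
    have : Finsupp.domCongr Fin.revPerm a ≤ Finsupp.domCongr Fin.revPerm b := fun i => by
      simpa using h _
    exact MonomialOrder.degLex.toSyn_monotone this

theorem reverseDegLex_lt_iff {a b : Fin (n + 1) →₀ ℕ} :
    a ≺[reverseDegLex n] b ↔
      Finsupp.domCongr Fin.revPerm a ≺[MonomialOrder.degLex] Finsupp.domCongr Fin.revPerm b :=
  Iff.rfl

theorem isGradedOrder_reverseDegLex (n : ℕ) : IsGradedOrder (reverseDegLex n) := by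
  intro a b h
  rw [reverseDegLex_lt_iff, MonomialOrder.degLex_lt_iff, Finsupp.DegLex.lt_iff]
  left
  simpa [Finsupp.equivMapDomain_eq_mapDomain, Finsupp.degree_mapDomain] using h

theorem reverseDegLex_single_zero_lt (i : Fin n) :
    Finsupp.single 0 1 ≺[reverseDegLex n] Finsupp.single i.succ 1 := by
  rw [reverseDegLex_lt_iff, Finsupp.domCongr_apply, Finsupp.domCongr_apply,
    Finsupp.equivMapDomain_single, Finsupp.equivMapDomain_single,
    MonomialOrder.degLex_single_lt_iff]
  exact Fin.rev_lt_rev.2 (Fin.succ_pos i)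

end GeilCarvalho

/-! ### Minimising the product under a budget -/

section GreedyProduct

/-- The product of the `k i - c i` for the `c` that spends the budget `D` greedily, starting with
the smallest index and never exceeding `k i - 1`. -/
def greedyProduct : (n : ℕ) → (Fin n → ℕ) → ℕ → ℕ
  | 0, _, _ => 1
  | n + 1, k, D => if D < k 0 then (k 0 - D) * ∏ i : Fin n, k i.succ
      else greedyProduct n (fun i => k i.succ) (D - (k 0 - 1))

/-- On the right all of `x` goes into the first factor, so the claim is (m - x) k_0 ≤ m (k_0 - x),
that is, m x ≤ k_0 x. A budget is better spent on a smaller factor. -/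
theorem sub_mul_prod_le_mul_greedyProduct {n : ℕ} {k : Fin n → ℕ} {m x : ℕ} (hx : x < m)
    (hk : ∀ i, m ≤ k i) : (m - x) * ∏ i, k i ≤ m * greedyProduct n k x := by
  cases n with
  | zero => simp [greedyProduct]
  | succ n =>
    have h0 := hk 0
    rw [greedyProduct, if_pos (hx.trans_le h0), Fin.prod_univ_succ, ← mul_assoc, ← mul_assoc]
    refine Nat.mul_le_mul_right _ ?_
    obtain ⟨u, rfl⟩ := Nat.exists_eq_add_of_lt hx
    obtain ⟨v, hv⟩ := Nat.exists_eq_add_of_le h0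
    rw [hv, show x + u + 1 - x = u + 1 by omega, show x + u + 1 + v - x = u + 1 + v by omega]
    nlinarith [Nat.zero_le (x * v)]

/-- Extra budget `p` shrinks the greedy product by a factor of at most `p + 1`. If the extra budget
spills over the first factor, the previous lemma with `m = p + 1` applies to the part that spills
over. -/
theorem greedyProduct_le_mul_greedyProduct_add {n : ℕ} {k : Fin n → ℕ} {p : ℕ} (D : ℕ)
    (hk : ∀ i, p + 1 ≤ k i) :
    greedyProduct n k D ≤ (p + 1) * greedyProduct n k (D + p) := by
  induction n generalizing D with
  | zero => simp [greedyProduct]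
  | succ n ih =>
    have h0 := hk 0
    rw [greedyProduct, greedyProduct]
    by_cases h1 : D + p < k 0
    · rw [if_pos h1, if_pos (by omega), ← mul_assoc]
      refine Nat.mul_le_mul_right _ ?_
      obtain ⟨u, hu⟩ := Nat.exists_eq_add_of_lt h1
      rw [hu, show D + p + u + 1 - D = p + (u + 1) by omega,
        show D + p + u + 1 - (D + p) = u + 1 by omega]
      nlinarith [Nat.zero_le (p * u)]
    · rw [if_neg h1]
      by_cases h2 : D < k 0
      · rw [if_pos h2]
        have := sub_mul_prod_le_mul_greedyProduct (k := fun i : Fin n => k i.succ) (m := p + 1)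
          (x := D + p - (k 0 - 1)) (by omega) fun i => hk i.succ
        rwa [show p + 1 - (D + p - (k 0 - 1)) = k 0 - D by omega] at this
      · rw [if_neg h2, show D + p - (k 0 - 1) = D - (k 0 - 1) + p by omega]
        exact ih _ fun i => hk i.succ

/-- Exchange argument by induction: the tail is replaced by its greedy optimum, and then budget is
moved from it to coordinate 0. The two preceding lemmas cover the cases where the budget fits into
coordinate 0 or fills it; both need k_0 - c_0 ≤ k_i, which monotonicity supplies. -/
theorem greedyProduct_le_prod {n : ℕ} {k c : Fin n → ℕ} (hk : Monotone k)
    (hc : ∀ i, c i < k i) {D : ℕ} (hD : ∑ i, c i ≤ D) :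
    greedyProduct n k D ≤ ∏ i, (k i - c i) := by
  induction n generalizing D with
  | zero => simp [greedyProduct]
  | succ n ih =>
    rw [Fin.sum_univ_succ] at hD
    have h0 := hc 0
    have hk0 : ∀ i : Fin n, k 0 - c 0 ≤ k i.succ := fun i =>
      (Nat.sub_le _ _).trans (hk (Fin.zero_le _))
    have := ih (k := fun i => k i.succ) (c := fun i => c i.succ)
      (fun i j hij => hk (Fin.succ_le_succ_iff.2 hij)) (fun i => hc i.succ)
      (D := D - c 0) (by omega)
    rw [Fin.prod_univ_succ]
    refine le_trans ?_ (Nat.mul_le_mul_left _ this)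
    rw [greedyProduct]
    split_ifs with h
    · have := sub_mul_prod_le_mul_greedyProduct (k := fun i : Fin n => k i.succ)
        (m := k 0 - c 0) (x := D - c 0) (by omega) hk0
      rwa [show k 0 - c 0 - (D - c 0) = k 0 - D by omega] at this
    · obtain ⟨p, hp⟩ := Nat.exists_eq_add_of_lt h0
      have := greedyProduct_le_mul_greedyProduct_add (k := fun i : Fin n => k i.succ) (p := p)
        (D - (k 0 - 1)) fun i => by have := hk0 i; omega
      rwa [show D - (k 0 - 1) + p = D - c 0 by omega, show p + 1 = k 0 - c 0 by omega] at this

theorem sum_Iio_eq_sum_ite {n : ℕ} (f : Fin n → ℕ) (j : Fin n) :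
    ∑ i ∈ Finset.Iio j, f i = ∑ i, if i < j then f i else 0 := by
  rw [← Finset.sum_filter]
  congr 1
  ext i
  simp

theorem prod_Ioi_eq_prod_ite {n : ℕ} (f : Fin n → ℕ) (j : Fin n) :
    ∏ i ∈ Finset.Ioi j, f i = ∏ i, if j < i then f i else 1 := by
  rw [← Finset.prod_filter]
  congr 1
  ext i
  simp

theorem sum_Iio_succ {n : ℕ} (f : Fin (n + 1) → ℕ) (j : Fin n) :
    ∑ i ∈ Finset.Iio j.succ, f i = f 0 + ∑ i ∈ Finset.Iio j, f i.succ := by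
  rw [sum_Iio_eq_sum_ite, sum_Iio_eq_sum_ite, Fin.sum_univ_succ]
  simp

theorem greedyProduct_eq {n : ℕ} {k : Fin n → ℕ} {j : Fin n} {l : ℕ} (hl : 1 ≤ l)
    (hlk : l ≤ k j - 1) :
    greedyProduct n k ((∑ i ∈ Finset.Iio j, (k i - 1)) + l) =
      (k j - l) * ∏ i ∈ Finset.Ioi j, k i := by
  induction n with
  | zero => exact j.elim0
  | succ n ih =>
    rw [greedyProduct]
    induction j using Fin.cases with
    | zero =>
      have : (Finset.Iio (0 : Fin (n + 1))) = ∅ := by ext i; simp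
      rw [this, Finset.sum_empty, zero_add, if_pos (by omega), prod_Ioi_eq_prod_ite,
        Fin.prod_univ_succ]
      simp
    | succ j =>
      rw [sum_Iio_succ, if_neg (by omega), add_assoc, Nat.add_sub_cancel_left,
        ih (k := fun i => k i.succ) (j := j) hlk, prod_Ioi_eq_prod_ite, prod_Ioi_eq_prod_ite,
        Fin.prod_univ_succ]
      simp

theorem exists_greedy_index {n : ℕ} {k : Fin n → ℕ} {D : ℕ} (hD : 1 ≤ D)
    (hDk : D ≤ ∑ i, (k i - 1)) :
    ∃ (j : Fin n) (l : ℕ), D = (∑ i ∈ Finset.Iio j, (k i - 1)) + l ∧ 1 ≤ l ∧ l ≤ k j - 1 := by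
  induction n generalizing D with
  | zero => simp at hDk; omega
  | succ n ih =>
    rw [Fin.sum_univ_succ] at hDk
    by_cases h : D ≤ k 0 - 1
    · have : (Finset.Iio (0 : Fin (n + 1))) = ∅ := by ext i; simp
      exact ⟨0, D, by simp [this], hD, h⟩
    · obtain ⟨j, l, hjl, hl, hlk⟩ := ih (k := fun i => k i.succ) (D := D - (k 0 - 1)) (by omega)
        (by omega)
      refine ⟨j.succ, l, ?_, hl, hlk⟩
      rw [sum_Iio_succ]
      omega

/-- If j < j', the sum up to j' already contains k_j - 1 ≥ l, and l' ≥ 1 makes the right side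
strictly larger. -/
theorem greedy_index_le {n : ℕ} {k : Fin n → ℕ} {j j' : Fin n} {l l' : ℕ}
    (h : (∑ i ∈ Finset.Iio j, (k i - 1)) + l = (∑ i ∈ Finset.Iio j', (k i - 1)) + l')
    (hlk : l ≤ k j - 1) (hl' : 1 ≤ l') : j' ≤ j := by
  by_contra! hlt
  have hsub : insert j (Finset.Iio j) ⊆ Finset.Iio j' := by
    intro i hi
    rw [Finset.mem_insert, Finset.mem_Iio] at hi
    rw [Finset.mem_Iio]
    rcases hi with rfl | hi
    · exact hlt
    · exact hi.trans hlt
  have := Finset.sum_le_sum_of_subset (f := fun i => k i - 1) hsub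
  rw [Finset.sum_insert (by simp)] at this
  omega

theorem existsUnique_greedy_index {n : ℕ} {k : Fin n → ℕ} {D : ℕ} (hD : 1 ≤ D)
    (hDk : D ≤ ∑ i, (k i - 1)) :
    ∃! p : Fin n × ℕ, D = (∑ i ∈ Finset.Iio p.1, (k i - 1)) + p.2 ∧ 1 ≤ p.2 ∧
      p.2 ≤ k p.1 - 1 := by
  obtain ⟨j, l, hjl, hl, hlk⟩ := exists_greedy_index hD hDk
  refine ⟨(j, l), ⟨hjl, hl, hlk⟩, ?_⟩
  rintro ⟨j', l'⟩ ⟨hjl', hl', hlk'⟩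
  simp only at hjl' hl' hlk'
  have h := hjl.symm.trans hjl'
  obtain rfl : j = j' := le_antisymm (greedy_index_le h.symm hlk' hl) (greedy_index_le h hlk hl')
  simpa using h.symm

theorem exists_greedy_exponent {n : ℕ} {k : Fin n → ℕ} (hk : ∀ i, 1 ≤ k i) {j : Fin n} {l : ℕ}
    (hlk : l ≤ k j - 1) :
    ∃ c : Fin n → ℕ, (∀ i, c i < k i) ∧
      ∑ i, c i = (∑ i ∈ Finset.Iio j, (k i - 1)) + l ∧
      ∏ i, (k i - c i) = (k j - l) * ∏ i ∈ Finset.Ioi j, k i := by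
  refine ⟨fun i => if i < j then k i - 1 else if i = j then l else 0, fun i => ?_, ?_, ?_⟩
  · have := hk i
    have := hk j
    dsimp only
    split_ifs with h1 h2
    · omega
    · subst h2; omega
    · omega
  · rw [sum_Iio_eq_sum_ite]
    have : ∑ i, (if i = j then l else 0) = l := by simp
    conv_rhs => rw [← this]
    rw [← Finset.sum_add_distrib]
    refine Finset.sum_congr rfl fun i _ => ?_
    split_ifs with h1 h2 <;> simp_all
  · rw [prod_Ioi_eq_prod_ite]
    have : ∏ i, (if i = j then k j - l else 1) = k j - l := by simp
    conv_rhs => rw [← this]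
    rw [← Finset.prod_mul_distrib]
    refine Finset.prod_congr rfl fun i _ => ?_
    rcases lt_trichotomy i j with h | rfl | h
    · have := hk i
      simp only [h, h.ne, h.not_gt, if_true, if_false]
      omega
    · simp
    · simp [h, h.ne', h.not_gt]

end GreedyProduct

/-! ### Weights and minimum distance of the code -/

section Codes

variable {K : Type*} [Field K] {n : ℕ}

theorem mk_chartPoint_injective {x y : Fin n → K}
    (h : Projectivization.mk K (chartPoint x) (cons_one_ne_zero x) =
      Projectivization.mk K (chartPoint y) (cons_one_ne_zero y)) : x = y := by
  obtain ⟨c, hc⟩ := (Projectivization.mk_eq_mk_iff' K _ _ _ _).1 h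
  have h0 : c = 1 := by simpa using congrFun hc 0
  funext i
  simpa [h0] using (congrFun hc i.succ).symm

open Classical in
/-- The weight of the codeword of a form is its number of nonzeros on the grid. -/
theorem ncard_support_evalMap {A : Fin n → Finset K} {d : ℕ}
    {g : cartesianSet A → MvPolynomial (Fin (n + 1)) K}
    (hg : IsNormalizingFamily (cartesianSet A) d g)
    (f : homogeneousSubmodule (Fin (n + 1)) K d) :
    (Function.support (evalMap (cartesianSet A) d g f)).ncard =
      ((Fintype.piFinset A).filter fun x => eval (chartPoint x) f.1 ≠ 0).card := by
  rw [← Set.ncard_coe_finset]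
  symm
  have hiff : ∀ (x : Fin n → K) (hx), evalMap (cartesianSet A) d g f
      ⟨Projectivization.mk K (chartPoint x) (cons_one_ne_zero x), hx⟩ ≠ 0 ↔
        eval (chartPoint x) f.1 ≠ 0 := fun x hx => by
    refine (div_ne_zero_iff.trans (and_iff_left (hg _).2)).trans ?_
    exact not_congr (eval_rep_eq_zero_iff f.2 x)
  refine Set.ncard_congr (fun x hx => ⟨Projectivization.mk K (chartPoint x) (cons_one_ne_zero x),
    x, Fintype.mem_piFinset.1 (Finset.mem_filter.1 hx).1, rfl⟩) ?_ ?_ ?_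
  · intro x hx
    exact (hiff x _).2 (Finset.mem_filter.1 hx).2
  · intro x y hx hy h
    exact mk_chartPoint_injective (congrArg Subtype.val h)
  · rintro ⟨P, x, hx, rfl⟩ hP
    exact ⟨x, Finset.mem_coe.2 (Finset.mem_filter.2
      ⟨Fintype.mem_piFinset.2 hx, (hiff x _).1 hP⟩), rfl⟩

/-- A codeword depends on its form only modulo I(X), so a nonzero one comes from a nonzero form in
the box. The leading exponent of that form gives a `c` to which the footprint bound applies. -/
theorem minimumDistance_reedMullerCode_eq {A : Fin n → Finset K} {d : ℕ}
    {g : cartesianSet A → MvPolynomial (Fin (n + 1)) K}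
    (hg : IsNormalizingFamily (cartesianSet A) d g) {N : ℕ}
    (hex : ∃ c : Fin n → ℕ, (∀ i, c i < (A i).card) ∧ ∑ i, c i ≤ d ∧
      ∏ i, ((A i).card - c i) = N)
    (hmin : ∀ c : Fin n → ℕ, (∀ i, c i < (A i).card) → ∑ i, c i ≤ d →
      N ≤ ∏ i, ((A i).card - c i)) :
    minimumDistance (reedMullerCode (cartesianSet A) d g) = N := by
  classical
  refine IsLeast.csInf_eq ⟨?_, ?_⟩
  · obtain ⟨c, hc, hcd, rfl⟩ := hex
    obtain ⟨f, hf, -, hcard⟩ := exists_form_card_nonzeros_eq A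
      (a := homogenizedExponent d c) fun i => by simpa using hc i
    rw [degree_homogenizedExponent hcd] at hf
    simp only [homogenizedExponent_succ] at hcard
    have hw := ncard_support_evalMap hg ⟨f, hf⟩
    rw [hcard] at hw
    refine ⟨evalMap (cartesianSet A) d g ⟨f, hf⟩, LinearMap.mem_range_self _ _, fun h0 => ?_,
      hw.symm⟩
    rw [h0] at hw
    have : 0 < ∏ i : Fin n, ((A i).card - c i) :=
      Finset.prod_pos fun j _ => Nat.sub_pos_of_lt (hc j)
    simp at hw
    omega
  · rintro w ⟨v, ⟨f, rfl⟩, hv, rfl⟩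
    rw [ncard_support_evalMap hg]
    -- Any order with t_0 smallest would do. The remainder need not be homogeneous, but I(X) is
    -- graded, so its component of degree `d` still represents `f`.
    obtain ⟨r₀, hr₀, hbox₀, -⟩ := exists_normalForm reverseDegLex_single_zero_lt A f.1
    have hr := homogeneousComponent_isHomogeneous d r₀
    have hfr := homogeneousComponent_mem_vanishingIdeal_cartesianSet hr₀ d
    rw [map_sub, homogeneousComponent_eq_self f.2] at hfr
    set r := homogeneousComponent d r₀
    have hbox : ∀ a ∈ r.support, InBox A a := fun a ha => by
      rw [support_homogeneousComponent] at ha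
      exact hbox₀ a (Finset.mem_filter.1 ha).1
    have heval : ∀ x ∈ Fintype.piFinset A, eval (chartPoint x) f.1 = eval (chartPoint x) r :=
      fun x hx => by
        have := (mem_vanishingIdeal_cartesianSet_iff_of_isHomogeneous
          (IsHomogeneous.sub f.2 hr)).1 hfr x hx
        rwa [map_sub, sub_eq_zero] at this
    rw [Finset.filter_congr fun x hx => by rw [heval x hx]]
    have hr0 : r ≠ 0 := by
      intro h
      refine hv (funext fun P => ?_)
      obtain ⟨P, x, hx, rfl⟩ := P
      have : eval (Projectivization.mk K (chartPoint x) (cons_one_ne_zero x)).rep f.1 = 0 :=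
        (eval_rep_eq_zero_iff f.2 x).2 (by rw [heval x (Fintype.mem_piFinset.2 hx), h, map_zero])
      exact div_eq_zero_iff.2 (Or.inl this)
    have hlead := (reverseDegLex n).degree_mem_support hr0
    refine le_trans (hmin (fun i => (reverseDegLex n).degree r i.succ) (hbox _ hlead) ?_)
      (prod_sub_le_card_nonzeros reverseDegLex_single_zero_lt hr hr0)
    have := degree_eq_of_mem_support hr hlead
    rw [degree_eq_add_sum] at this
    omega

end Codes

end FootprintCodes

end

theorem mainTheorem5 {K : Type*} [Field K] (n : ℕ) (hn : 1 ≤ n) (A : Fin n → Finset K)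
    (hpos : ∀ i, 1 ≤ (A i).card) (hmono : Monotone fun i => (A i).card) :
    (∀ d : ℕ, 1 ≤ d →
      ∀ g : FootprintCodes.cartesianSet A → MvPolynomial (Fin (n + 1)) K,
      FootprintCodes.IsNormalizingFamily (FootprintCodes.cartesianSet A) d g →
        (d < ∑ i, ((A i).card - 1) →
          (∃! p : Fin n × ℕ,
            d = (∑ i ∈ Finset.Iio p.1, ((A i).card - 1)) + p.2 ∧
              1 ≤ p.2 ∧ p.2 ≤ (A p.1).card - 1) ∧
          ∀ (k : Fin n) (l : ℕ), d = (∑ i ∈ Finset.Iio k, ((A i).card - 1)) + l →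
            1 ≤ l → l ≤ (A k).card - 1 →
            FootprintCodes.minimumDistance
              (FootprintCodes.reedMullerCode (FootprintCodes.cartesianSet A) d g) =
              ((A k).card - l) * ∏ i ∈ Finset.Ioi k, (A i).card) ∧
        (∑ i, ((A i).card - 1) ≤ d →
          FootprintCodes.minimumDistance
            (FootprintCodes.reedMullerCode (FootprintCodes.cartesianSet A) d g) = 1)) ∧
    FootprintCodes.IsGeilCarvalho
      (FootprintCodes.vanishingIdeal (FootprintCodes.cartesianSet A)) ∧
    (∀ m : MonomialOrder (Fin (n + 1)), FootprintCodes.IsGradedOrder m →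
      (∀ i : Fin n, Finsupp.single 0 1 ≺[m] Finsupp.single i.succ 1) →
      ∀ d : ℕ, 1 ≤ d →
        FootprintCodes.minDistFunction m
            (FootprintCodes.vanishingIdeal (FootprintCodes.cartesianSet A)) d =
          FootprintCodes.footprintFunction m
            (FootprintCodes.vanishingIdeal (FootprintCodes.cartesianSet A)) d) := by
  refine ⟨fun d hd g hg => ⟨fun hlt => ⟨?_, fun k l hkl hl hlk => ?_⟩, fun hle => ?_⟩, ?_, ?_⟩
  · exact FootprintCodes.existsUnique_greedy_index (k := fun i => (A i).card) hd hlt.le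
  · obtain ⟨c, hc, hcsum, hcprod⟩ :=
      FootprintCodes.exists_greedy_exponent (k := fun i => (A i).card) hpos hlk
    refine FootprintCodes.minimumDistance_reedMullerCode_eq hg
      ⟨c, hc, (hcsum.trans hkl.symm).le, hcprod⟩ fun c hc hcd => ?_
    rw [← FootprintCodes.greedyProduct_eq (k := fun i => (A i).card) hl hlk, ← hkl]
    exact FootprintCodes.greedyProduct_le_prod hmono hc hcd
  -- The budget suffices to reduce every factor to 1, and no product of positive factors is smaller.
  · refine FootprintCodes.minimumDistance_reedMullerCode_eq hg
      ⟨fun i => (A i).card - 1, fun i => Nat.sub_one_lt_of_lt (hpos i), hle, ?_⟩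
      fun c hc _ => Finset.prod_pos fun i _ => Nat.sub_pos_of_lt (hc i)
    exact Finset.prod_eq_one fun i _ => Nat.sub_sub_self (hpos i)
  · exact ⟨FootprintCodes.reverseDegLex n, FootprintCodes.isGradedOrder_reverseDegLex n,
      fun d _ => FootprintCodes.minDistFunction_eq_footprintFunction
        FootprintCodes.reverseDegLex_single_zero_lt hpos d⟩
  · exact fun m _ hm d _ => FootprintCodes.minDistFunction_eq_footprintFunction hm hpos d
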